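/- **Model.** Let $n\ge 3$, $1\le b\le n$ be integers, $0<a<1$, $0<p<1$. A firm has $b$ units to sell over $n$ periods. A customer sequence is $v=(v_1,\dots,v_n)\in\{0,a,1\}^n$: in period $i$ a type-1 customer ($v_i=1$), a type-2 customer ($v_i=a$) or no customer ($v_i=0$) arrives; each accepted customer uses one unit and yields revenue $v_i$. If $v$ contains $n_1$ type-1 and $n_2$ type-2 customers, the optimum offline revenue is $OPT(v)=\min\{b,n_1\}+a\min\{n_2,(b-n_1)^+\}$. In the partially predictable model an adversary fixes an initial sequence $v_I$; each $i\in\{1,\dots,n\}$ joins a set $\mathcal S$ independently with probability $p$; given $\mathcal S$, a permutation $\sigma$ of $\mathcal S$ is drawn uniformly; the arriving sequence $V$ is $V_{\sigma(i)}=v_{I,i}$ for $i\in\mathcal S$ and $V_i=v_{I,i}$ for $i\notin\mathcal S$. An online algorithm with revenue $ALG(\cdot)$ is $\rho$-competitive if $\mathbb E[ALG(V)]\ge\rho\,OPT(v_I)$ for every $v_I\in\{0,a,1\}^n$. **Algorithm $ALG_{2,c}$** ($0\le c<1$). For $0<\lambda\le 1$ and real $o$ put $U(\lambda,o)=\min\Big\{\frac{o}{\lambda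 p},\ \frac{o+(1-\lambda)(1-p)n}{1-p+\lambda p}\Big\}$. Let $\phi=\frac{1-c}{1-a}$, $\delta=\frac{\phi b}{n}$. For $\lambda=1/n,2/n,\dots,1$ let $o_j(\lambda)$ be the number of type-$j$ customers among $v_1,\dots,v_{\lambda n}$, and define $u_1(\lambda)=u_{1,2}(\lambda)=b$ if $\lambda<\delta$, and $u_1(\lambda)=U(\lambda,o_1(\lambda))$, $u_{1,2}(\lambda)=U(\lambda,o_1(\lambda)+o_2(\lambda))$ if $\lambda\ge\delta$. Let $q_1,q_2$ (initially $0$) count the accepted customers of each type. The customer of period $i=\lambda n$ is accepted if and only if $q_1+q_2<b$ and one of the following holds: $v_i=1$; or $v_i=a$ and $u_{1,2}(\lambda)<b$; or $v_i=a$ and $q_2\le\lfloor \phi b+c\,(b-u_1(\lambda))^+\rfloor$. **Factor-revealing program (MP1).** Let $c^*=c^*(n,b,a,p)$ be the optimal value (infimum) of $c$ over all reals $l\in(0,1]$, $n_1,n_2,\eta_1,\eta_2,c\ge0$ satisfying $$c\ \ge\ \frac{a\big(n_2-\tilde o_2+\frac{b}{1-a}\big)+n_1}{a\min\{n_1+n_2,b\}+(1-a)n_1+\frac{a^2b}{1-a}+a\min\{\tilde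 u_1,b\}},\qquad \tilde u_{1,2}\ge b,$$ $$\eta_1+\eta_2\le l n,\quad \eta_1\le n_1,\quad \eta_2\le n_2,\quad n_1\le b,\quad n_1+n_2\le n,\quad n_1+n_2\le\eta_1+\eta_2+(1-l)n,$$ where $\tilde o_j=(1-p)\eta_j+p\,n_j l$, $\tilde u_1=U(l,\tilde o_1)$, $\tilde u_{1,2}=U(l,\tilde o_1+\tilde o_2)$. **Theorem.** There is an absolute constant $K>0$ such that for all integers $n\ge3$ and $1\le b\le n$, all $a,p\in(0,1)$, and all $c\in[0,1)$ with $c\le c^*(n,b,a,p)$, the algorithm $ALG_{2,c}$ is $$\left(c-K\,\frac{1}{(1-c)^2\,a\,p^{3/2}}\sqrt{\frac{n^2\log n}{b^3}}\right)\text{-competitive}$$ in the partially predictable model. -/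

import Mathlib

open scoped BigOperators

namespace OnlineAlloc

/-- What happens in one period: nobody arrives (value `0`), a type-1 customer arrives (value `1`),
or a type-2 customer arrives (value `a`, with `0 < a < 1`). -/
inductive Customer where
  | none
  | type1
  | type2
  deriving DecidableEq

/-- The number of customers of kind `t` among the first `k` periods of the sequence `v`. -/
def count {n : ℕ} (v : Fin n → Customer) (t : Customer) (k : ℕ) : ℕ :=
  (Finset.univ.filter fun i : Fin n => (i : ℕ) < k ∧ v i = t).card

noncomputable section

/-- The optimum offline revenue with inventory `b`:
`min {b, n₁} + a * min {n₂, (b - n₁)⁺}`. The subtraction is the truncated one of `ℕ`, that is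
`(b - n₁)⁺`. -/
def opt {n : ℕ} (b : ℕ) (a : ℝ) (v : Fin n → Customer) : ℝ :=
  ((min b (count v .type1 n) : ℕ) : ℝ)
    + a * ((min (count v .type2 n) (b - count v .type1 n) : ℕ) : ℝ)

/-! ### The partially predictable arrival model -/

/-- The arriving sequence obtained from the initial sequence `vI` when the stochastic group is `S`
and it is permuted by `σ`: customer `i ∈ S` arrives in period `σ i`, and every customer outside `S`
keeps its period. -/
def arrival {n : ℕ} (vI : Fin n → Customer) (S : Finset (Fin n)) (σ : Equiv.Perm S) :
    Fin n → Customer :=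
  fun j => if h : j ∈ S then vI (σ.symm ⟨j, h⟩) else vI j

/-- The expectation of `f V`, where `V` is the random arrival sequence: each customer joins the
stochastic group `S` independently with probability `p`, and given `S` the permutation of `S` is
uniform over its `|S|!` permutations. -/
def expect {n : ℕ} (p : ℝ) (vI : Fin n → Customer) (f : (Fin n → Customer) → ℝ) : ℝ :=
  ∑ S : Finset (Fin n), p ^ S.card * (1 - p) ^ (n - S.card) *
    ((∑ σ : Equiv.Perm S, f (arrival vI S σ)) / (S.card.factorial : ℝ))

/-- A (deterministic) online algorithm, given by its revenue `alg v` on each arriving sequence `v`,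
is `ρ`-competitive in the partially predictable model:
`E[alg V] ≥ ρ * OPT(vI)` for every initial sequence `vI`. -/
def IsCompetitive (n b : ℕ) (a p : ℝ) (alg : (Fin n → Customer) → ℝ) (ρ : ℝ) : Prop :=
  ∀ vI : Fin n → Customer, ρ * opt b a vI ≤ expect p vI alg

/-! ### The adaptive algorithm -/

/-- `min {o / (l p), (o + (1 - l) (1 - p) n) / (1 - p + l p)}`: the estimate of a total number of
customers from the number `o` of them that arrived up to time `l`. -/
def estimate (n : ℕ) (p l o : ℝ) : ℝ :=
  min (o / (l * p)) ((o + (1 - l) * (1 - p) * n) / (1 - p + l * p))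

/-- `φ = (1 - c) / (1 - a)`. -/
def phi (a c : ℝ) : ℝ := (1 - c) / (1 - a)

/-- `δ = φ b / n`. -/
def delta (n b : ℕ) (a c : ℝ) : ℝ := phi a c * b / n

/-- The bound used at time `l`, if `o` customers (of the kinds counted) arrived up to time `l`:
it is `b` for `l < δ`, and the estimate above for `l ≥ δ`. -/
def upperBound (n b : ℕ) (a p c l o : ℝ) : ℝ :=
  if l < delta n b a c then (b : ℝ) else estimate n p l o

/-- `u₁` at time `k / n`, which bounds the number of type-1 customers. -/
def u1 {n : ℕ} (b : ℕ) (a p c : ℝ) (v : Fin n → Customer) (k : ℕ) : ℝ :=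
  upperBound n b a p c ((k : ℝ) / n) (count v .type1 k : ℝ)

/-- `u₁₂` at time `k / n`, which bounds the number of customers of both types. -/
def u12 {n : ℕ} (b : ℕ) (a p c : ℝ) (v : Fin n → Customer) (k : ℕ) : ℝ :=
  upperBound n b a p c ((k : ℝ) / n) ((count v .type1 k : ℝ) + (count v .type2 k : ℝ))

open Classical in
/-- The counters `(q₁, q₂)` of customers accepted by the adaptive algorithm with parameter `c`
after the first `k` periods. The customer `v ⟨k, _⟩` arrives at time `(k + 1) / n`, and the
decision on it uses the customers seen up to and including that time. -/
def accepted {n : ℕ} (b : ℕ) (a p c : ℝ) (v : Fin n → Customer) : ℕ → ℕ × ℕ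
  | 0 => (0, 0)
  | k + 1 =>
    let q := accepted b a p c v k
    if h : k < n then
      if q.1 + q.2 < b then
        match v ⟨k, h⟩ with
        | .none => q
        | .type1 => (q.1 + 1, q.2)
        | .type2 =>
          if u12 b a p c v (k + 1) < b ∨
              (q.2 : ℤ) ≤ ⌊phi a c * b + c * max ((b : ℝ) - u1 b a p c v (k + 1)) 0⌋ then
            (q.1, q.2 + 1)
          else q
      else q
    else q

/-- The revenue `q₁ + a q₂` of the adaptive algorithm with parameter `c` on the arriving
sequence `v`. -/
def adaptiveRevenue (n b : ℕ) (a p c : ℝ) (v : Fin n → Customer) : ℝ :=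
  ((accepted b a p c v n).1 : ℝ) + a * ((accepted b a p c v n).2 : ℝ)

/-! ### The factor-revealing program -/

/-- Feasibility of `(l, n₁, n₂, η₁, η₂, c)` for the factor-revealing program with data `n, b, a, p`.
The variables are nonnegative reals, and the time `l` is positive. -/
def MPFeasible (n b : ℕ) (a p l n₁ n₂ η₁ η₂ c : ℝ) : Prop :=
  let o₁ := (1 - p) * η₁ + p * n₁ * l
  let o₂ := (1 - p) * η₂ + p * n₂ * l
  0 < l ∧ 0 ≤ n₁ ∧ 0 ≤ n₂ ∧ 0 ≤ η₁ ∧ 0 ≤ η₂ ∧ 0 ≤ c ∧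
  (a * (n₂ - o₂ + b / (1 - a)) + n₁) /
      (a * min (n₁ + n₂) b + (1 - a) * n₁ + a ^ 2 * b / (1 - a)
        + a * min (estimate n p l o₁) b) ≤ c ∧
  (b : ℝ) ≤ estimate n p l (o₁ + o₂) ∧
  l ≤ 1 ∧
  η₁ + η₂ ≤ l * n ∧
  η₁ ≤ n₁ ∧
  η₂ ≤ n₂ ∧
  n₁ ≤ b ∧
  n₁ + n₂ ≤ n ∧
  n₁ + n₂ ≤ η₁ + η₂ + (1 - l) * n

/-- The optimal value `c*` of the factor-revealing program (minimize `c` over the feasible region).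
The region is nonempty for `1 ≤ b ≤ n`, `0 < a < 1`, `0 < p < 1` (take `l = 1`, `n₁ = η₁ = b`,
`n₂ = η₂ = 0`, `c = 1`), and `c` is bounded below by `0` on it. -/
def cStar (n b : ℕ) (a p : ℝ) : ℝ :=
  sInf {c : ℝ | ∃ l n₁ n₂ η₁ η₂ : ℝ, MPFeasible n b a p l n₁ n₂ η₁ η₂ c}

end

end OnlineAlloc

/-!
Write `n₁`, `n₂` for the numbers of customers of the two types, and fix a sample path on which, at
all times `k / n`, the number of arrivals from each of three fixed sets of customers is within `Δ`
of its idealized mean `meanArrived`. The loss of the algorithm on such a path is determined by its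
last decision about a type-2 customer.

* If inventory is left over at the end, all type-1 customers were accepted, and so were all type-2
  customers after the last rejection (`accepted_of_lt`). The revenue is therefore at least `n₁` plus
  `a` times the sum of the rejection level and the number of type-2 customers still to arrive. With
  the means in place of the numbers of arrivals, the objective constraint of the factor-revealing
  program says exactly that a fraction less than `c*` of `opt` is impossible here. The constraint
  `b ≤ ũ₁₂` holds for the observed quantities and hence, for the means, only up to `Δ`. The remedy
  is to move the point, by adding type-2 customers in empty periods, until the constraint holds
  (`mul_opt_le_of_le_cStar`).
* If the inventory is exhausted, only an excess of type-2 customers can do harm. The last accepted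
  one met the level, which is right up to the error of the estimate of `n₁`, or it was accepted
  because few customers were expected, and then there is almost no competition for the inventory
  (`adaptiveRevenue_ge_of_eq`).

Times before `δ` play no role, and at later times `Δ` causes an error of `Δ n / (p (1 - c) b)` in the
estimates. Since `opt ≥ a (1 - c) b` whenever the algorithm is not optimal, the error term of the
theorem requires `Δ` of order `√(b log n / p)`, and not `√(n log n)`. This is why the three sets are
truncated to at most `2 b` customers: only that many matter (`adaptiveRevenue_ge`).

For the concentration, the deviation of the number of arrivals from a set `T` splits into a weighted
sum of independent Bernoulli variables (which members of `T` join the stochastic group `S`), a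
centered hypergeometric variable (which of these the permutation moves to early periods), and
`|T ∩ S| / |S|` times another Bernoulli sum (how many periods of `S` are early); see
`arrived_sub_meanArrived`. The exponential moments of the hypergeometric variable are dominated by
those of a Poisson variable, by induction on the set and a correlation inequality
(`sum_exp_hits_le`). Chernoff bounds and a union bound over all times finish the proof.
-/

namespace OnlineAlloc

/-! ### The estimate and the factor-revealing program -/

theorem le_estimate_iff {n : ℕ} {p l o x : ℝ} (hl : 0 < l) (hp : 0 < p) (hp1 : p < 1) :
    x ≤ estimate n p l o ↔
      x * (l * p) ≤ o ∧ x * (1 - p + l * p) ≤ o + (1 - l) * (1 - p) * n := by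
  have h1 : 0 < l * p := mul_pos hl hp
  have h2 : 0 < 1 - p + l * p := by linarith
  rw [estimate, le_min_iff, le_div_iff₀ h1, le_div_iff₀ h2]

/-- The estimate is monotone and `1 / (l p)`-Lipschitz in the number of observed customers. -/
theorem estimate_le_add {n : ℕ} {p l o o' d : ℝ} (hl : 0 < l) (hp : 0 < p) (hp1 : p < 1)
    (hd : 0 ≤ d) (h : o ≤ o' + d) :
    estimate n p l o ≤ estimate n p l o' + d / (l * p) := by
  have h1 : 0 < l * p := mul_pos hl hp
  have h2 : 0 < 1 - p + l * p := by linarith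
  have h3 : d / (1 - p + l * p) ≤ d / (l * p) :=
    div_le_div_of_nonneg_left hd h1 (by linarith)
  rw [estimate, estimate, ← min_add_add_right]
  refine min_le_min ?_ ?_
  · rw [← add_div]; gcongr
  · calc (o + (1 - l) * (1 - p) * n) / (1 - p + l * p)
        ≤ (o' + (1 - l) * (1 - p) * n + d) / (1 - p + l * p) := by
          gcongr ?_ / _; linarith
      _ ≤ _ := by rw [add_div]; linarith

theorem estimate_mono {n : ℕ} {p l o o' : ℝ} (hl : 0 < l) (hp : 0 < p) (hp1 : p < 1)
    (h : o ≤ o') : estimate n p l o ≤ estimate n p l o' := by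
  simpa using estimate_le_add (n := n) hl hp hp1 le_rfl (by simpa using h)

/-- Evaluated at the expected number of customers seen up to time `l`, the estimate is an upper
bound on the total number `N` of customers. -/
theorem le_estimate_mean {n : ℕ} {p l η N : ℝ} (hl : 0 < l) (hp : 0 < p) (hp1 : p < 1)
    (hη : 0 ≤ η) (hN : N ≤ η + (1 - l) * n) :
    N ≤ estimate n p l ((1 - p) * η + p * N * l) := by
  have hp1' : 0 < 1 - p := by linarith
  rw [le_estimate_iff hl hp hp1]
  constructor
  · nlinarith [mul_nonneg hp1'.le hη]
  · nlinarith [mul_le_mul_of_nonneg_left hN hp1'.le]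

/-- The guarantee encoded in the factor-revealing program, made robust: the constraint
`b ≤ ũ₁₂` is only required after the expected number of observed customers is increased by `D`.
The given point is moved towards the sequence in which every period without a customer receives a
type-2 customer, just far enough to restore the constraint. -/
theorem mul_opt_le_of_le_cStar {n b : ℕ} {a p c l n₁ n₂ η₁ η₂ D : ℝ} (hb : 1 ≤ b) (hbn : b ≤ n)
    (ha : 0 < a) (ha1 : a < 1) (hp : 0 < p) (hp1 : p < 1) (hc : 0 ≤ c) (hcs : c ≤ cStar n b a p)
    (hl : 0 < l) (hl1 : l ≤ 1) (hη₁ : 0 ≤ η₁) (hη₂ : 0 ≤ η₂)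
    (hηl : η₁ + η₂ ≤ l * n) (h1 : η₁ ≤ n₁) (h2 : η₂ ≤ n₂) (hn₁b : n₁ ≤ b) (hNn : n₁ + n₂ ≤ n)
    (hN : n₁ + n₂ ≤ η₁ + η₂ + (1 - l) * n) (hD : 0 ≤ D)
    (hu : (b : ℝ) ≤ estimate n p l
      (((1 - p) * η₁ + p * n₁ * l) + ((1 - p) * η₂ + p * n₂ * l) + D)) :
    c * (a * min (n₁ + n₂) b + (1 - a) * n₁) ≤
      n₁ + a * (n₂ - ((1 - p) * η₂ + p * n₂ * l) + (phi a c * b +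
        c * max ((b : ℝ) - estimate n p l ((1 - p) * η₁ + p * n₁ * l)) 0)) + a * (D / (p * l)) := by
  have hp1' : 0 < 1 - p := by linarith
  have ha1' : 0 < 1 - a := by linarith
  have hbR : (1 : ℝ) ≤ b := by exact_mod_cast hb
  have hbnR : (b : ℝ) ≤ n := by exact_mod_cast hbn
  have hpl : 0 < p * l := mul_pos hp hl
  set o₁ := (1 - p) * η₁ + p * n₁ * l with ho₁
  set o₂ := (1 - p) * η₂ + p * n₂ * l with ho₂
  set g := (1 - p) * (l * n - (η₁ + η₂)) + p * l * (n - (n₁ + n₂)) with hg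
  have hg1 : g = l * n - (o₁ + o₂) := by rw [hg, ho₁, ho₂]; ring
  have hgA : 0 ≤ (1 - p) * (l * n - (η₁ + η₂)) := mul_nonneg hp1'.le (by linarith)
  have hgB : 0 ≤ p * l * (n - (n₁ + n₂)) := mul_nonneg hpl.le (by linarith)
  have hg0 : 0 ≤ g := by linarith
  obtain ⟨t, ht0, ht1, htD, htu⟩ : ∃ t : ℝ, 0 ≤ t ∧ t ≤ 1 ∧ t * g ≤ D ∧
      (b : ℝ) ≤ estimate n p l (o₁ + (o₂ + t * g)) := by
    rcases le_or_gt g D with h | h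
    · refine ⟨1, zero_le_one, le_rfl, by linarith, ?_⟩
      rw [le_estimate_iff hl hp hp1, hg1]
      constructor
      · have e1 : l * b ≤ l * n := mul_le_mul_of_nonneg_left hbnR hl.le
        have e2 : p * (l * b) ≤ 1 * (l * b) :=
          mul_le_mul_of_nonneg_right hp1.le (by positivity)
        linarith
      · have e1 : (1 - p + l * p) * b ≤ (1 - p + l * p) * n :=
          mul_le_mul_of_nonneg_left hbnR (by nlinarith)
        linarith
    · refine ⟨D / g, by positivity, (div_le_one (by linarith)).2 h.le, ?_, ?_⟩
      · rw [div_mul_cancel₀]; linarith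
      · rw [div_mul_cancel₀ _ (by linarith)]
        rwa [← add_assoc]
  set m₂ := n₂ + t * (n - (n₁ + n₂)) with hm₂
  set ζ₂ := η₂ + t * (l * n - (η₁ + η₂)) with hζ₂
  have hto : (1 - p) * ζ₂ + p * m₂ * l = o₂ + t * g := by
    rw [hζ₂, hm₂, ho₂, hg]; ring
  have hm : n₂ ≤ m₂ := by
    have : 0 ≤ t * (n - (n₁ + n₂)) := mul_nonneg ht0 (by linarith)
    linarith
  have hmD : m₂ ≤ n₂ + D / (p * l) := by
    have : t * (n - (n₁ + n₂)) ≤ D / (p * l) := by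
      rw [le_div_iff₀ hpl]
      rw [hg] at htD
      linarith [mul_nonneg ht0 hgA]
    linarith
  have hζ : η₂ ≤ ζ₂ := by
    have : 0 ≤ t * (l * n - (η₁ + η₂)) := mul_nonneg ht0 (by linarith)
    linarith
  have hζm : ζ₂ ≤ m₂ := by
    rw [hζ₂, hm₂]
    linarith [mul_nonneg ht0 (show 0 ≤ (η₁ + η₂) + (1 - l) * n - (n₁ + n₂) by linarith),
      h2]
  have hO : o₂ + t * g ≤ m₂ := by
    have hm0 : 0 ≤ m₂ := by linarith
    have h5 : l * m₂ ≤ 1 * m₂ := mul_le_mul_of_nonneg_right hl1 hm0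
    rw [← hto]
    linarith [mul_le_mul_of_nonneg_left hζm hp1'.le, mul_le_mul_of_nonneg_left h5 hp.le]
  set den := a * min (n₁ + m₂) b + (1 - a) * n₁ + a ^ 2 * b / (1 - a)
        + a * min (estimate n p l o₁) b with hden
  set num := a * (m₂ - (o₂ + t * g) + b / (1 - a)) + n₁ with hnum
  have hest : n₁ ≤ estimate n p l o₁ := le_estimate_mean hl hp hp1 hη₁ (by linarith)
  have hn₁ : 0 ≤ n₁ := by linarith
  have hden0 : 0 < den := by
    have e1 : 0 ≤ min (n₁ + m₂) (b : ℝ) := le_min (by linarith) (by linarith)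
    have e2 : 0 ≤ min (estimate n p l o₁) (b : ℝ) := le_min (by linarith) (by linarith)
    have e3 : 0 < a ^ 2 * b / (1 - a) := by positivity
    have e4 := mul_nonneg ha.le e1
    have e5 := mul_nonneg ha.le e2
    have e6 := mul_nonneg ha1'.le hn₁
    rw [hden]; linarith
  have hnum0 : 0 ≤ num := by
    have e1 : 0 ≤ b / (1 - a) := by positivity
    have := mul_nonneg ha.le (show 0 ≤ m₂ - (o₂ + t * g) + b / (1 - a) by linarith)
    rw [hnum]; linarith
  have hfeas : MPFeasible n b a p l n₁ m₂ η₁ ζ₂ (num / den) := by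
    refine ⟨hl, hn₁, by linarith, hη₁, by linarith, by positivity, ?_, ?_, hl1, ?_, h1, hζm,
      hn₁b, ?_, ?_⟩
    · rw [hto]
    · rw [hto]; exact htu
    · rw [hζ₂]
      linarith [mul_nonneg (show 0 ≤ 1 - t by linarith) (show 0 ≤ l * n - (η₁ + η₂) by linarith)]
    · rw [hm₂]
      linarith [mul_nonneg (show 0 ≤ 1 - t by linarith) (show 0 ≤ n - (n₁ + n₂) by linarith)]
    · rw [hζ₂, hm₂]
      linarith [mul_nonneg (show 0 ≤ 1 - t by linarith)
        (show 0 ≤ (η₁ + η₂) + (1 - l) * n - (n₁ + n₂) by linarith)]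
  have hle : cStar n b a p ≤ num / den := by
    refine csInf_le ⟨0, ?_⟩ ⟨l, n₁, m₂, η₁, ζ₂, hfeas⟩
    rintro x ⟨_, _, _, _, _, h⟩
    exact h.2.2.2.2.2.1
  have hcd : c * den ≤ num := by
    rw [← le_div_iff₀ hden0]; exact hcs.trans hle
  have hmax : max ((b : ℝ) - estimate n p l o₁) 0 = b - min (estimate n p l o₁) b := by
    rcases le_total (estimate n p l o₁) (b : ℝ) with h | h
    · rw [min_eq_left h, max_eq_left (by linarith)]
    · rw [min_eq_right h, max_eq_right (by linarith), sub_self]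
  have hmin : min (n₁ + n₂) (b : ℝ) ≤ min (n₁ + m₂) b := min_le_min (by linarith) le_rfl
  have hphi : a * (phi a c * b) = a * (b / (1 - a)) - c * (a ^ 2 * b / (1 - a)) - c * a * b := by
    rw [phi]; field_simp; ring
  have htg : 0 ≤ t * g := mul_nonneg ht0 hg0
  have e1 : c * (a * min (n₁ + n₂) b) ≤ c * (a * min (n₁ + m₂) b) := by gcongr
  have e2 : a * m₂ ≤ a * (n₂ + D / (p * l)) := by gcongr
  have e3 : 0 ≤ a * (t * g) := mul_nonneg ha.le htg
  rw [hmax]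
  rw [hden, hnum] at hcd
  linarith

/-! ### Sample paths of the algorithm -/

/-- The level that the number of accepted type-2 customers may not exceed for a further type-2
customer to be accepted at time `k / n`. -/
noncomputable def threshold {n : ℕ} (b : ℕ) (a p c : ℝ) (v : Fin n → Customer) (k : ℕ) : ℝ :=
  phi a c * b + c * max ((b : ℝ) - u1 b a p c v k) 0

theorem count_zero {n : ℕ} (v : Fin n → Customer) (t : Customer) : count v t 0 = 0 := by
  simp [count]

theorem count_succ {n : ℕ} (v : Fin n → Customer) (t : Customer) {k : ℕ} (hk : k < n) :
    count v t (k + 1) = count v t k + if v ⟨k, hk⟩ = t then 1 else 0 := by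
  unfold count
  split_ifs with h
  · have : (Finset.univ.filter fun i : Fin n => (i : ℕ) < k + 1 ∧ v i = t) =
        insert ⟨k, hk⟩ (Finset.univ.filter fun i : Fin n => (i : ℕ) < k ∧ v i = t) := by
      ext i
      simp only [Finset.mem_filter, Finset.mem_univ, true_and, Finset.mem_insert, Fin.ext_iff]
      constructor
      · rintro ⟨h1, h2⟩
        rcases Nat.lt_succ_iff_lt_or_eq.1 h1 with h3 | h3
        · exact Or.inr ⟨h3, h2⟩
        · exact Or.inl h3
      · rintro (h1 | ⟨h1, h2⟩)
        · have : i = ⟨k, hk⟩ := Fin.ext h1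
          exact ⟨by omega, this ▸ h⟩
        · exact ⟨by omega, h2⟩
    rw [this, Finset.card_insert_of_notMem (by simp)]
  · rw [add_zero]
    congr 1
    ext i
    simp only [Finset.mem_filter, Finset.mem_univ, true_and, and_congr_left_iff]
    intro h2
    constructor
    · intro h1
      rcases Nat.lt_succ_iff_lt_or_eq.1 h1 with h3 | h3
      · exact h3
      · exact absurd ((show i = ⟨k, hk⟩ from Fin.ext h3) ▸ h2) h
    · omega

/-- The possible transitions in one period: the inventory is exhausted, nobody arrives, a type-1
customer is accepted, a type-2 customer is accepted, or a type-2 customer is rejected. -/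
theorem accepted_succ_cases {n : ℕ} (b : ℕ) (a p c : ℝ) (v : Fin n → Customer) {k : ℕ}
    (hk : k < n) :
    let q := accepted b a p c v k
    let q' := accepted b a p c v (k + 1)
    (b ≤ q.1 + q.2 ∧ q' = q) ∨
    (q.1 + q.2 < b ∧ v ⟨k, hk⟩ = .none ∧ q' = q) ∨
    (q.1 + q.2 < b ∧ v ⟨k, hk⟩ = .type1 ∧ q' = (q.1 + 1, q.2)) ∨
    (q.1 + q.2 < b ∧ v ⟨k, hk⟩ = .type2 ∧ q' = (q.1, q.2 + 1) ∧
      (u12 b a p c v (k + 1) < b ∨ (q.2 : ℝ) ≤ threshold b a p c v (k + 1))) ∨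
    (q.1 + q.2 < b ∧ v ⟨k, hk⟩ = .type2 ∧ q' = q ∧
      (b : ℝ) ≤ u12 b a p c v (k + 1) ∧ threshold b a p c v (k + 1) < q.2) := by
  intro q q'
  have hq' : q' = accepted b a p c v (k + 1) := rfl
  have hfl : ((q.2 : ℤ) ≤ ⌊phi a c * b + c * max ((b : ℝ) - u1 b a p c v (k + 1)) 0⌋) ↔
      (q.2 : ℝ) ≤ threshold b a p c v (k + 1) := by
    rw [Int.le_floor, threshold, Int.cast_natCast]
  rw [accepted] at hq'
  simp only [hk, dif_pos] at hq'
  rcases lt_or_ge (q.1 + q.2) b with hlt | hge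
  · right
    rw [if_pos hlt] at hq'
    rcases hv : v ⟨k, hk⟩ with _ | _ | _
    · left; rw [hv] at hq'; exact ⟨hlt, rfl, hq'⟩
    · right; left; rw [hv] at hq'; exact ⟨hlt, rfl, hq'⟩
    · right; right
      rw [hv] at hq'
      simp only at hq'
      by_cases hacc : u12 b a p c v (k + 1) < b ∨ (q.2 : ℝ) ≤ threshold b a p c v (k + 1)
      · left
        rw [← hfl] at hacc
        rw [if_pos hacc] at hq'
        rw [hfl] at hacc
        exact ⟨hlt, rfl, hq', hacc⟩
      · right
        have hacc' := hacc
        rw [← hfl] at hacc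
        rw [if_neg hacc] at hq'
        push Not at hacc'
        exact ⟨hlt, rfl, hq', hacc'.1, hacc'.2⟩
  · left
    rw [if_neg (not_lt.2 hge)] at hq'
    exact ⟨hge, hq'⟩

theorem accepted_bounds {n : ℕ} (b : ℕ) (a p c : ℝ) (v : Fin n → Customer) (k : ℕ) (hk : k ≤ n) :
    (accepted b a p c v k).1 + (accepted b a p c v k).2 ≤ b ∧
    (accepted b a p c v k).1 ≤ count v .type1 k ∧
    (accepted b a p c v k).2 ≤ count v .type2 k ∧
    (accepted b a p c v k).2 ≤ k := by
  induction k with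
  | zero => simp [accepted]
  | succ k ih =>
    obtain ⟨i1, i2, i3, i4⟩ := ih (by omega)
    have hkn : k < n := by omega
    rw [count_succ v _ hkn, count_succ v _ hkn]
    rcases accepted_succ_cases b a p c v hkn with
      ⟨h1, h2⟩ | ⟨h1, h2, h3⟩ | ⟨h1, h2, h3⟩ | ⟨h1, h2, h3, h4⟩ | ⟨h1, h2, h3, h4⟩
    · rw [h2]; refine ⟨by omega, by omega, by omega, by omega⟩
    · rw [h3]; refine ⟨by omega, by omega, by omega, by omega⟩
    · rw [h3, h2]; simp; omega
    · rw [h3, h2]; simp; omega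
    · rw [h3]; refine ⟨by omega, by omega, by omega, by omega⟩

/-- If inventory is left, all type-1 customers were accepted, and all type-2 customers after the
last rejection were accepted as well. A rejection only occurs at a time `≥ δ`. -/
theorem accepted_of_lt {n : ℕ} {b : ℕ} {a p c : ℝ} (hc : 0 ≤ c)
    (v : Fin n → Customer) (m : ℕ) (hm : m ≤ n)
    (hlt : (accepted b a p c v m).1 + (accepted b a p c v m).2 < b) :
    (accepted b a p c v m).1 = count v .type1 m ∧
    ((accepted b a p c v m).2 = count v .type2 m ∨
      ∃ k, 1 ≤ k ∧ k ≤ m ∧ delta n b a c ≤ (k : ℝ) / n ∧ (b : ℝ) ≤ u12 b a p c v k ∧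
        threshold b a p c v k + ((count v .type2 m : ℝ) - count v .type2 k) ≤
          ((accepted b a p c v m).2 : ℝ)) := by
  induction m with
  | zero => simp [accepted, count_zero]
  | succ m ih =>
    have hmn : m < n := by omega
    have hstep := accepted_succ_cases b a p c v hmn
    rw [count_succ v _ hmn, count_succ v _ hmn]
    rcases hstep with
      ⟨h1, h2⟩ | ⟨h1, h2, h3⟩ | ⟨h1, h2, h3⟩ | ⟨h1, h2, h3, h4⟩ | ⟨h1, h2, h3, h4, h5⟩
    · rw [h2] at hlt; omega
    · obtain ⟨i1, i2⟩ := ih (by omega) h1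
      rw [h3, h2]
      refine ⟨by simpa using i1, ?_⟩
      rcases i2 with i2 | ⟨k, k1, k2, k3, k4, k5⟩
      · exact Or.inl (by simpa using i2)
      · exact Or.inr ⟨k, k1, by omega, k3, k4, by simpa using k5⟩
    · obtain ⟨i1, i2⟩ := ih (by omega) h1
      rw [h3, h2]
      refine ⟨by simpa using i1, ?_⟩
      rcases i2 with i2 | ⟨k, k1, k2, k3, k4, k5⟩
      · exact Or.inl (by simpa using i2)
      · exact Or.inr ⟨k, k1, by omega, k3, k4, by simpa using k5⟩
    · obtain ⟨i1, i2⟩ := ih (by omega) h1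
      rw [h3, h2]
      refine ⟨by simpa using i1, ?_⟩
      rcases i2 with i2 | ⟨k, k1, k2, k3, k4, k5⟩
      · exact Or.inl (by simpa using i2)
      · refine Or.inr ⟨k, k1, by omega, k3, k4, ?_⟩
        simp only [if_true]
        push_cast
        linarith
    · obtain ⟨i1, i2⟩ := ih (by omega) h1
      rw [h3]
      refine ⟨by rw [h2]; simpa using i1, Or.inr ⟨m + 1, by omega, le_rfl, ?_, h4, ?_⟩⟩
      · by_contra hcon
        push Not at hcon
        have hn : (0 : ℝ) < n := by exact_mod_cast (by omega : 0 < n)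
        rw [delta, div_lt_div_iff_of_pos_right hn] at hcon
        have hq : ((accepted b a p c v m).2 : ℝ) ≤ m := by
          exact_mod_cast (accepted_bounds b a p c v m hmn.le).2.2.2
        have hthr : phi a c * b ≤ threshold b a p c v (m + 1) := by
          rw [threshold]
          have := mul_nonneg hc (le_max_right ((b : ℝ) - u1 b a p c v (m + 1)) 0)
          linarith
        push_cast at hcon
        linarith
      · rw [count_succ v _ hmn, sub_self, add_zero]
        exact h5.le

/-- The state of the counter of accepted type-2 customers at the last acceptance. -/
theorem accepted_snd_cases {n : ℕ} (b : ℕ) (a p c : ℝ) (v : Fin n → Customer) (m : ℕ)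
    (hm : m ≤ n) :
    (accepted b a p c v m).2 = 0 ∨
      ∃ k, 1 ≤ k ∧ k ≤ m ∧ (u12 b a p c v k < b ∨
        ((accepted b a p c v m).2 : ℝ) ≤ threshold b a p c v k + 1) := by
  induction m with
  | zero => simp [accepted]
  | succ m ih =>
    have hmn : m < n := by omega
    have ih := ih (by omega)
    have same : (accepted b a p c v (m + 1)).2 = (accepted b a p c v m).2 →
        ((accepted b a p c v (m + 1)).2 = 0 ∨ ∃ k, 1 ≤ k ∧ k ≤ m + 1 ∧ (u12 b a p c v k < b ∨
          ((accepted b a p c v (m + 1)).2 : ℝ) ≤ threshold b a p c v k + 1)) := by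
      intro h
      rw [h]
      rcases ih with i | ⟨k, k1, k2, k3⟩
      · exact Or.inl i
      · exact Or.inr ⟨k, k1, by omega, k3⟩
    rcases accepted_succ_cases b a p c v hmn with
      ⟨h1, h2⟩ | ⟨h1, h2, h3⟩ | ⟨h1, h2, h3⟩ | ⟨h1, h2, h3, h4⟩ | ⟨h1, h2, h3, h4, h5⟩
    · exact same (by rw [h2])
    · exact same (by rw [h3])
    · exact same (by rw [h3])
    · refine Or.inr ⟨m + 1, by omega, le_rfl, ?_⟩
      rw [h3]
      rcases h4 with h4 | h4
      · exact Or.inl h4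
      · right; push_cast; linarith
    · exact same (by rw [h3])

/-! ### The guarantee on a typical sample path -/

/-- The number of customers of the set `T` that arrive in the first `k` periods, if customer `i`
arrives in period `π i`. -/
def arrived {n : ℕ} (π : Equiv.Perm (Fin n)) (T : Finset (Fin n)) (k : ℕ) : ℕ :=
  (T.filter fun i => (π i : ℕ) < k).card

/-- The idealized expected value of `arrived π T k`: a customer keeps its period with probability
`1 - p`, and otherwise arrives in the first `k` periods with probability `k / n`. -/
noncomputable def meanArrived {n : ℕ} (p : ℝ) (T : Finset (Fin n)) (k : ℕ) : ℝ :=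
  (1 - p) * ((T.filter fun i : Fin n => (i : ℕ) < k).card : ℝ) + p * (T.card : ℝ) * ((k : ℝ) / n)

/-- The set of customers of kind `t`. -/
def kind {n : ℕ} (vI : Fin n → Customer) (t : Customer) : Finset (Fin n) :=
  Finset.univ.filter fun i => vI i = t

theorem card_kind {n : ℕ} (vI : Fin n → Customer) (t : Customer) :
    (kind vI t).card = count vI t n := by
  simp [kind, count]

theorem count_eq_arrived {n : ℕ} {v vI : Fin n → Customer} {π : Equiv.Perm (Fin n)}
    (h : ∀ i, v (π i) = vI i) (t : Customer) (k : ℕ) :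
    count v t k = arrived π (kind vI t) k := by
  symm
  unfold arrived count kind
  refine Finset.card_bij (fun i _ => π i) ?_ (fun i _ j _ hij => π.injective hij) ?_
  · intro i hi
    simp only [Finset.mem_filter, Finset.mem_univ, true_and] at hi ⊢
    exact ⟨hi.2, (h i).trans hi.1⟩
  · intro j hj
    simp only [Finset.mem_filter, Finset.mem_univ, true_and] at hj
    refine ⟨π.symm j, ?_, by simp⟩
    simp only [Finset.mem_filter, Finset.mem_univ, true_and, Equiv.apply_symm_apply]
    exact ⟨by rw [← h, Equiv.apply_symm_apply]; exact hj.2, hj.1⟩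

theorem count_perm {n : ℕ} {v vI : Fin n → Customer} {π : Equiv.Perm (Fin n)}
    (h : ∀ i, v (π i) = vI i) (t : Customer) : count v t n = count vI t n := by
  rw [count_eq_arrived h, ← card_kind, arrived, Finset.filter_true_of_mem]
  exact fun i _ => (π i).isLt

theorem arrived_mono {n : ℕ} (π : Equiv.Perm (Fin n)) {T T' : Finset (Fin n)} (h : T ⊆ T')
    (k : ℕ) : arrived π T k ≤ arrived π T' k :=
  Finset.card_le_card (Finset.filter_subset_filter _ h)

/-- If `T ⊆ T'`, then at least as many customers of `T'` as of `T` are still to arrive. -/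
theorem card_add_arrived_le {n : ℕ} (π : Equiv.Perm (Fin n)) {T T' : Finset (Fin n)} (h : T ⊆ T')
    (k : ℕ) : T.card + arrived π T' k ≤ T'.card + arrived π T k := by
  have h1 := Finset.card_filter_add_card_filter_not (s := T) fun i => (π i : ℕ) < k
  have h2 := Finset.card_filter_add_card_filter_not (s := T') fun i => (π i : ℕ) < k
  have h3 := Finset.card_le_card
    (Finset.filter_subset_filter (fun i : Fin n => ¬ (π i : ℕ) < k) h)
  unfold arrived
  omega

theorem card_fin_filter_lt {n k : ℕ} (hk : k ≤ n) :
    (Finset.univ.filter fun i : Fin n => (i : ℕ) < k).card = k := by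
  rw [Fin.card_filter_val_lt]; exact min_eq_right hk

theorem card_le_filter_lt_add {n k : ℕ} (hk : k ≤ n) (T : Finset (Fin n)) :
    (T.card : ℝ) ≤ ((T.filter fun i : Fin n => (i : ℕ) < k).card : ℝ) + (1 - (k : ℝ) / n) * n := by
  rcases Nat.eq_zero_or_pos n with rfl | hn
  · have : T = ∅ := Finset.eq_empty_of_isEmpty T
    simp [this]
  have hn' : (n : ℝ) ≠ 0 := by positivity
  have h1 := Finset.card_filter_add_card_filter_not (s := T) fun i : Fin n => (i : ℕ) < k
  have h2 : (T.filter fun i : Fin n => ¬ (i : ℕ) < k).card ≤ n - k := by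
    have h3 := Finset.card_filter_add_card_filter_not (s := (Finset.univ : Finset (Fin n)))
      fun i : Fin n => (i : ℕ) < k
    rw [card_fin_filter_lt hk, Finset.card_univ, Fintype.card_fin] at h3
    have := Finset.card_le_card (Finset.filter_subset_filter
      (fun i : Fin n => ¬ (i : ℕ) < k) (Finset.subset_univ T))
    omega
  have h4 : (1 - (k : ℝ) / n) * n = ((n - k : ℕ) : ℝ) := by
    rw [Nat.cast_sub hk]; field_simp
  rw [h4]
  exact_mod_cast (by omega)

theorem card_le_estimate_meanArrived {n k : ℕ} {p : ℝ} (hk1 : 1 ≤ k) (hk : k ≤ n) (hp : 0 < p)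
    (hp1 : p < 1) (T : Finset (Fin n)) :
    (T.card : ℝ) ≤ estimate n p ((k : ℝ) / n) (meanArrived p T k) := by
  have : (0 : ℝ) < n := by exact_mod_cast (by omega : 0 < n)
  have : (0 : ℝ) < k := by exact_mod_cast hk1
  exact le_estimate_mean (by positivity) hp hp1 (by positivity) (card_le_filter_lt_add hk T)

/-- At times `l ≥ δ`, an error `Δ` in the number of observed customers causes an error of at most
`Δ n / (p (1 - c) b)` in the estimate. -/
theorem error_bounds {n b k : ℕ} {a p c Δ : ℝ} (hb : 1 ≤ b) (hbn : b ≤ n)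
    (ha : 0 < a) (ha1 : a < 1) (hp : 0 < p) (hp1 : p < 1) (hc1 : c < 1) (hΔ : 0 ≤ Δ)
    (hk1 : 1 ≤ k) (hkn : k ≤ n) (hδ : delta n b a c ≤ (k : ℝ) / n) :
    0 < (k : ℝ) / n ∧ (k : ℝ) / n ≤ 1 ∧
      Δ / ((k : ℝ) / n * p) ≤ Δ * n / (p * (1 - c) * b) ∧ Δ ≤ Δ / ((k : ℝ) / n * p) := by
  have hbR : (1 : ℝ) ≤ b := by exact_mod_cast hb
  have hbnR : (b : ℝ) ≤ n := by exact_mod_cast hbn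
  have hn : (0 : ℝ) < n := by linarith
  have hc1' : 0 < 1 - c := by linarith
  have hphi : 1 - c ≤ phi a c := by
    rw [phi, le_div_iff₀ (by linarith)]; nlinarith
  have hk : (0 : ℝ) < k := by exact_mod_cast hk1
  have hl : 0 < (k : ℝ) / n := by positivity
  have hl1 : (k : ℝ) / n ≤ 1 := by rw [div_le_one hn]; exact_mod_cast hkn
  refine ⟨hl, hl1, ?_, ?_⟩
  · have h1 : (1 - c) * b / n ≤ (k : ℝ) / n := by
      refine le_trans ?_ hδ
      rw [delta]
      gcongr
    have h2 : Δ * n / (p * (1 - c) * b) = Δ / ((1 - c) * b / n * p) := by field_simp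
    rw [h2]
    gcongr
  · rw [le_div_iff₀ (by positivity)]
    have : (k : ℝ) / n * p ≤ 1 := by nlinarith
    nlinarith

theorem disjoint_kind {n : ℕ} (vI : Fin n → Customer) :
    Disjoint (kind vI .type1) (kind vI .type2) := by
  rw [Finset.disjoint_left]
  intro i hi hj
  simp only [kind, Finset.mem_filter, Finset.mem_univ, true_and] at hi hj
  rw [hi] at hj
  cases hj

theorem u1_eq {n b k : ℕ} {a p c : ℝ} {v vI : Fin n → Customer} {π : Equiv.Perm (Fin n)}
    (hv : ∀ i, v (π i) = vI i) (hδ : delta n b a c ≤ (k : ℝ) / n) :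
    u1 b a p c v k = estimate n p ((k : ℝ) / n) (arrived π (kind vI .type1) k) := by
  rw [u1, upperBound, if_neg (not_lt.2 hδ), count_eq_arrived hv]

theorem u12_eq {n b k : ℕ} {a p c : ℝ} {v vI : Fin n → Customer} {π : Equiv.Perm (Fin n)}
    (hv : ∀ i, v (π i) = vI i) (hδ : delta n b a c ≤ (k : ℝ) / n) :
    u12 b a p c v k = estimate n p ((k : ℝ) / n)
      ((arrived π (kind vI .type1) k : ℝ) + arrived π (kind vI .type2) k) := by
  rw [u12, upperBound, if_neg (not_lt.2 hδ), count_eq_arrived hv, count_eq_arrived hv]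

/-- The factor-revealing program applied to two disjoint sets of customers at the time `k / n`. -/
theorem mul_card_le_of_le_cStar {n b k : ℕ} {a p c D : ℝ} (hb : 1 ≤ b) (hbn : b ≤ n)
    (ha : 0 < a) (ha1 : a < 1) (hp : 0 < p) (hp1 : p < 1) (hc : 0 ≤ c) (hcs : c ≤ cStar n b a p)
    (hk1 : 1 ≤ k) (hkn : k ≤ n) (hD : 0 ≤ D) {T₁ T₂ : Finset (Fin n)} (hdisj : Disjoint T₁ T₂)
    (hTb : T₁.card + T₂.card ≤ b)
    (hu : T₁.card + T₂.card = b ∨ (b : ℝ) ≤ estimate n p ((k : ℝ) / n)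
      (meanArrived p T₁ k + meanArrived p T₂ k + D)) :
    c * (T₁.card + a * T₂.card) ≤
      T₁.card + a * (T₂.card - meanArrived p T₂ k + (phi a c * b +
        c * max ((b : ℝ) - estimate n p ((k : ℝ) / n) (meanArrived p T₁ k)) 0)) +
      a * (D / (p * ((k : ℝ) / n))) := by
  have hk : (0 : ℝ) < k := by exact_mod_cast hk1
  have hn : (0 : ℝ) < n := by exact_mod_cast (by omega : 0 < n)
  have hη : ((T₁.filter fun i : Fin n => (i : ℕ) < k).card : ℝ) +
      ((T₂.filter fun i : Fin n => (i : ℕ) < k).card : ℝ) =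
      (((T₁ ∪ T₂).filter fun i : Fin n => (i : ℕ) < k).card : ℝ) := by
    rw [Finset.filter_union, Finset.card_union_of_disjoint
      (Finset.disjoint_filter_filter hdisj)]
    push_cast; ring
  have hcardU : (T₁.card : ℝ) + T₂.card = ((T₁ ∪ T₂).card : ℝ) := by
    rw [Finset.card_union_of_disjoint hdisj]; push_cast; ring
  have hmean : meanArrived p T₁ k + meanArrived p T₂ k = meanArrived p (T₁ ∪ T₂) k := by
    simp only [meanArrived]
    rw [← hη, ← hcardU]; ring
  have hTbR : (T₁.card : ℝ) + T₂.card ≤ b := by exact_mod_cast hTb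
  have hl : 0 < (k : ℝ) / n := by positivity
  have hl1 : (k : ℝ) / n ≤ 1 := by rw [div_le_one hn]; exact_mod_cast hkn
  have hu' : (b : ℝ) ≤ estimate n p ((k : ℝ) / n)
      (meanArrived p T₁ k + meanArrived p T₂ k + D) := by
    rcases hu with hu | hu
    · have hcb : (b : ℝ) = ((T₁ ∪ T₂).card : ℝ) := by
        rw [← hcardU, ← hu]; push_cast; ring
      rw [hmean]
      refine (hcb.le.trans (card_le_estimate_meanArrived hk1 hkn hp hp1 _)).trans ?_
      exact estimate_mono hl hp hp1 (by linarith)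
    · exact hu
  have hηl : (((T₁ ∪ T₂).filter fun i : Fin n => (i : ℕ) < k).card : ℝ) ≤ (k : ℝ) / n * n := by
    have h3 : ((T₁ ∪ T₂).filter fun i : Fin n => (i : ℕ) < k).card ≤ k := by
      conv_rhs => rw [← card_fin_filter_lt hkn]
      exact Finset.card_le_card (Finset.filter_subset_filter _ (Finset.subset_univ _))
    have h4 : (k : ℝ) / n * n = k := by field_simp
    rw [h4]; exact_mod_cast h3
  have hT₁b : (T₁.card : ℝ) ≤ b := by
    have : (0 : ℝ) ≤ T₂.card := by positivity
    linarith
  have hbnR : (b : ℝ) ≤ n := by exact_mod_cast hbn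
  have hmp := mul_opt_le_of_le_cStar (n := n) (b := b) (a := a) (p := p) (c := c)
    (l := (k : ℝ) / n) (n₁ := T₁.card) (n₂ := T₂.card)
    (η₁ := ((T₁.filter fun i : Fin n => (i : ℕ) < k).card : ℝ))
    (η₂ := ((T₂.filter fun i : Fin n => (i : ℕ) < k).card : ℝ)) (D := D)
    hb hbn ha ha1 hp hp1 hc hcs hl hl1 (by positivity) (by positivity)
    (by rw [hη]; exact hηl)
    (by exact_mod_cast Finset.card_filter_le _ _) (by exact_mod_cast Finset.card_filter_le _ _)
    hT₁b (hTbR.trans hbnR)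
    (by rw [hη, hcardU]; exact card_le_filter_lt_add hkn _) hD hu'
  rw [min_eq_left hTbR] at hmp
  calc c * (T₁.card + a * T₂.card)
      = c * (a * ((T₁.card : ℝ) + T₂.card) + (1 - a) * T₁.card) := by ring
    _ ≤ _ := hmp

/-- If inventory is left over at the end, the worst case is described by the factor-revealing
program, evaluated at the time of the last rejection. -/
theorem adaptiveRevenue_ge_of_lt {n b : ℕ} {a p c Δ : ℝ} (hb : 1 ≤ b) (hbn : b ≤ n)
    (ha : 0 < a) (ha1 : a < 1) (hp : 0 < p) (hp1 : p < 1) (hc : 0 ≤ c) (hc1 : c < 1)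
    (hcs : c ≤ cStar n b a p) (hΔ : 0 ≤ Δ)
    {v vI : Fin n → Customer} {π : Equiv.Perm (Fin n)} (hv : ∀ i, v (π i) = vI i)
    {T₁ T₂ : Finset (Fin n)} (hT₁ : T₁ ⊆ kind vI .type1) (hT₂ : T₂ ⊆ kind vI .type2)
    (hT₁c : T₁.card = min b (count vI .type1 n))
    (hT₂c : T₂.card = min (count vI .type2 n) (b - count vI .type1 n))
    (hd1 : ∀ k, 1 ≤ k → k ≤ n → |(arrived π T₁ k : ℝ) - meanArrived p T₁ k| ≤ Δ)
    (hd2 : ∀ k, 1 ≤ k → k ≤ n → |(arrived π T₂ k : ℝ) - meanArrived p T₂ k| ≤ Δ)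
    (hlt : (accepted b a p c v n).1 + (accepted b a p c v n).2 < b) :
    opt b a vI ≤ adaptiveRevenue n b a p c v ∨
      (a * (1 - c) * b ≤ opt b a vI ∧
        c * opt b a vI - 4 * (Δ * n / (p * (1 - c) * b)) ≤ adaptiveRevenue n b a p c v) := by
  have hopt : opt b a vI = (T₁.card : ℝ) + a * (T₂.card : ℝ) := by rw [opt, hT₁c, hT₂c]
  obtain ⟨hq, hq1, hq2, -⟩ := accepted_bounds b a p c v n le_rfl
  obtain ⟨h1, h2⟩ := accepted_of_lt hc v n le_rfl hlt
  rw [count_perm hv] at hq1 hq2 h1 h2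
  rw [hopt, adaptiveRevenue]
  have e1 : T₁.card = count vI .type1 n := by clear h2; omega
  rcases h2 with h2 | ⟨k, hk1, hkn, hδ, hu, hthr⟩
  · left
    have e2 : T₂.card = count vI .type2 n := by omega
    rw [e1, e2, h1, h2]
  right
  obtain ⟨hl, hl1, hlE, hlΔ⟩ := error_bounds hb hbn ha ha1 hp hp1 hc1 hΔ hk1 hkn hδ
  have hT₁eq : T₁ = kind vI .type1 :=
    Finset.eq_of_subset_of_card_le hT₁ (by rw [card_kind, e1])
  have d1 := abs_le.1 (hd1 k hk1 hkn)
  have d2 := abs_le.1 (hd2 k hk1 hkn)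
  have hcase : (T₂ = kind vI .type2 ∧ count vI .type2 n = T₂.card) ∨ T₁.card + T₂.card = b := by
    rcases le_total (count vI .type1 n + count vI .type2 n) b with hle | hge
    · have e2 : T₂.card = count vI .type2 n := by omega
      exact Or.inl ⟨Finset.eq_of_subset_of_card_le hT₂ (by rw [card_kind, e2]), e2.symm⟩
    · right; omega
  rw [u12_eq hv hδ, ← hT₁eq] at hu
  rw [threshold, u1_eq hv hδ, ← hT₁eq, count_eq_arrived hv .type2 k] at hthr
  have hmp := mul_card_le_of_le_cStar (D := 2 * Δ) hb hbn ha ha1 hp hp1 hc hcs hk1 hkn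
    (by linarith only [hΔ]) (Finset.disjoint_of_subset_left hT₁
      (Finset.disjoint_of_subset_right hT₂ (disjoint_kind vI))) (by omega)
    (by
      rcases hcase with ⟨h, -⟩ | h
      · right
        rw [← h] at hu
        exact hu.trans (estimate_mono hl hp hp1 (by linarith only [d1, d2]))
      · exact Or.inl h)
  have hrem : (T₂.card : ℝ) - arrived π T₂ k ≤
      (count vI .type2 n : ℝ) - arrived π (kind vI .type2) k := by
    have h3 := card_add_arrived_le π hT₂ k
    rw [card_kind] at h3
    have h4 : (T₂.card : ℝ) + arrived π (kind vI .type2) k ≤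
      count vI .type2 n + arrived π T₂ k := by exact_mod_cast h3
    linarith only [h4]
  have hest := estimate_le_add (n := n) (o := arrived π T₁ k) (o' := meanArrived p T₁ k)
    hl hp hp1 hΔ (by linarith only [d1])
  have hq2' : ((accepted b a p c v n).2 : ℝ) ≤ count vI .type2 n := by exact_mod_cast hq2
  have harr : (arrived π (kind vI .type2) k : ℝ) ≤ count vI .type2 n := by
    rw [← card_kind]
    exact_mod_cast Finset.card_filter_le _ _
  rw [h1, ← e1]
  generalize ((accepted b a p c v n).2 : ℝ) = q at *
  generalize (arrived π (kind vI .type2) k : ℝ) = A at *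
  generalize estimate n p ((k : ℝ) / n) (arrived π T₁ k) = e at *
  generalize estimate n p ((k : ℝ) / n) (meanArrived p T₁ k) = e' at *
  generalize Δ * n / (p * (1 - c) * b) = E at *
  have hcE : c * E ≤ 1 * E := mul_le_mul_of_nonneg_right hc1.le (by linarith only [hΔ, hlΔ, hlE])
  have haE : a * E ≤ 1 * E := mul_le_mul_of_nonneg_right ha1.le (by linarith only [hΔ, hlΔ, hlE])
  have hcb : 0 ≤ c * b := by positivity
  have hc0 : (1 - c) * b ≤ phi a c * b := by
    refine mul_le_mul_of_nonneg_right ?_ (by positivity)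
    rw [phi, le_div_iff₀ (by linarith only [ha1])]
    nlinarith only [ha, hc1]
  have hmax0 := mul_nonneg hc (le_max_right ((b : ℝ) - e) 0)
  constructor
  · have h3 : (1 - c) * b ≤ (T₁.card : ℝ) + T₂.card := by
      rcases hcase with ⟨-, h⟩ | h
      · have h0 : (0 : ℝ) ≤ T₁.card := Nat.cast_nonneg _
        rw [h] at hq2' harr
        rw [h] at hthr
        linarith only [hc0, hmax0, hthr, hq2', harr, h0]
      · have h' : (T₁.card : ℝ) + T₂.card = b := by exact_mod_cast h
        linarith only [hcb, h']
    have h4 : a * (T₁.card : ℝ) ≤ 1 * (T₁.card : ℝ) :=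
      mul_le_mul_of_nonneg_right ha1.le (Nat.cast_nonneg _)
    have h5 := mul_le_mul_of_nonneg_left h3 ha.le
    linarith only [h4, h5]
  · have hmax : max ((b : ℝ) - e') 0 ≤ max ((b : ℝ) - e) 0 + E := by
      have h3 := le_max_left ((b : ℝ) - e) 0
      have h4 := le_max_right ((b : ℝ) - e) 0
      exact max_le (by linarith only [h3, hest, hlE]) (by linarith only [h4, hΔ, hlΔ, hlE])
    have h3 : 2 * Δ / (p * ((k : ℝ) / n)) ≤ 2 * E := by
      have : 2 * Δ / (p * ((k : ℝ) / n)) = 2 * (Δ / ((k : ℝ) / n * p)) := by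
        rw [mul_comm p]; ring
      rw [this]; linarith only [hlE]
    have h4 := mul_le_mul_of_nonneg_left h3 ha.le
    have h5 := mul_le_mul_of_nonneg_left hmax hc
    have h6 : ((T₂.card : ℝ) - meanArrived p T₂ k + (phi a c * b + c * max ((b : ℝ) - e') 0)) ≤
        q + 2 * E := by
      linarith only [h5, hcE, hthr, hrem, d2, hlΔ, hlE]
    have h7 := mul_le_mul_of_nonneg_left h6 ha.le
    linarith only [hmp, h7, h4, haE]

/-- If the inventory is exhausted, the loss is due to type-2 customers. The reason for the
acceptance of the last of them bounds their number. -/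
theorem adaptiveRevenue_ge_of_eq {n b : ℕ} {a p c Δ : ℝ} (hb : 1 ≤ b) (hbn : b ≤ n)
    (ha : 0 < a) (ha1 : a < 1) (hp : 0 < p) (hp1 : p < 1) (hc : 0 ≤ c) (hc1 : c < 1)
    (hΔ : 0 ≤ Δ)
    {v vI : Fin n → Customer} {π : Equiv.Perm (Fin n)} (hv : ∀ i, v (π i) = vI i)
    {T₁ T : Finset (Fin n)} (hT₁ : T₁ ⊆ kind vI .type1)
    (hT : T ⊆ kind vI .type1 ∪ kind vI .type2)
    (hT₁c : T₁.card = min b (count vI .type1 n))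
    (hTc : T.card = min (count vI .type1 n + count vI .type2 n) (2 * b))
    (hd1 : ∀ k, 1 ≤ k → k ≤ n → |(arrived π T₁ k : ℝ) - meanArrived p T₁ k| ≤ Δ)
    (hd : ∀ k, 1 ≤ k → k ≤ n → |(arrived π T k : ℝ) - meanArrived p T k| ≤ Δ)
    (heq : (accepted b a p c v n).1 + (accepted b a p c v n).2 = b) :
    opt b a vI ≤ adaptiveRevenue n b a p c v ∨
      (a * (1 - c) * b ≤ opt b a vI ∧
        c * opt b a vI - (Δ * n / (p * (1 - c) * b) + 1) ≤ adaptiveRevenue n b a p c v) := by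
  have ha1' : 0 < 1 - a := by linarith
  have hc1' : 0 < 1 - c := by linarith
  have hE : 0 ≤ Δ * n / (p * (1 - c) * b) := by positivity
  have est_close : ∀ X : Finset (Fin n),
      (∀ k, 1 ≤ k → k ≤ n → |(arrived π X k : ℝ) - meanArrived p X k| ≤ Δ) →
      ∀ k, 1 ≤ k → k ≤ n → delta n b a c ≤ (k : ℝ) / n →
      (X.card : ℝ) ≤ estimate n p ((k : ℝ) / n) (arrived π X k) +
        Δ * n / (p * (1 - c) * b) := by
    intro X hX k hk1 hkn hδ
    obtain ⟨hl, hl1, hlE, -⟩ := error_bounds hb hbn ha ha1 hp hp1 hc1 hΔ hk1 hkn hδ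
    have h1 := card_le_estimate_meanArrived hk1 hkn hp hp1 X
    have h2 := abs_le.1 (hX k hk1 hkn)
    have h3 := estimate_le_add (n := n) (o := meanArrived p X k) (o' := arrived π X k)
      hl hp hp1 hΔ (by linarith only [h2])
    linarith only [h1, h3, hlE]
  obtain ⟨-, hq1, hq2, -⟩ := accepted_bounds b a p c v n le_rfl
  rw [count_perm hv] at hq1 hq2
  have hsnd := accepted_snd_cases b a p c v n le_rfl
  rw [adaptiveRevenue]
  generalize accepted b a p c v n = q at *
  have hq' : (q.1 : ℝ) + q.2 = b := by exact_mod_cast heq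
  have hT₁b : (T₁.card : ℝ) ≤ b := by exact_mod_cast (by clear hsnd; omega)
  have hopt' : opt b a vI = a * b + (1 - a) * T₁.card := by
    have h3 : T₁.card + min (count vI .type2 n) (b - count vI .type1 n) = b := by
      clear hsnd; omega
    have h4 : (T₁.card : ℝ) + (min (count vI .type2 n) (b - count vI .type1 n) : ℕ) = b := by
      exact_mod_cast h3
    rw [opt, ← hT₁c]
    linear_combination a * h4
  have hrev : (q.1 : ℝ) + a * q.2 = b - (1 - a) * q.2 := by rw [← hq']; ring
  have hoptb : opt b a vI ≤ b := by
    rw [hopt']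
    have := mul_le_mul_of_nonneg_left hT₁b ha1'.le
    linarith only [this]
  have hopt0 : 0 ≤ opt b a vI := by rw [hopt']; positivity
  rw [hrev]
  rcases hsnd with h0 | ⟨k, hk1, hkn, hk⟩
  · left
    rw [h0]
    simpa using hoptb
  right
  refine ⟨?_, ?_⟩
  · rw [hopt']
    have h1 : 0 ≤ (1 - a) * (T₁.card : ℝ) := by positivity
    have h2 : 0 ≤ a * c * b := by positivity
    linarith only [h1, h2]
  have hcopt : c * opt b a vI ≤ 1 * opt b a vI := mul_le_mul_of_nonneg_right hc1.le hopt0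
  rcases hk with hk | hk
  · -- the last accepted type-2 customer was accepted since few customers were expected
    have hδ : delta n b a c ≤ (k : ℝ) / n := by
      by_contra hcon
      rw [u12, upperBound, if_pos (not_le.1 hcon)] at hk
      exact lt_irrefl _ hk
    obtain ⟨hl, -, -, -⟩ := error_bounds hb hbn ha ha1 hp hp1 hc1 hΔ hk1 hkn hδ
    rw [u12_eq hv hδ] at hk
    have h1 : (arrived π T k : ℝ) ≤
        (arrived π (kind vI .type1) k : ℝ) + arrived π (kind vI .type2) k := by
      have h2 := arrived_mono π hT k
      have h3 : arrived π (kind vI .type1 ∪ kind vI .type2) k ≤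
          arrived π (kind vI .type1) k + arrived π (kind vI .type2) k := by
        unfold arrived
        rw [Finset.filter_union]
        exact Finset.card_union_le _ _
      exact_mod_cast h2.trans h3
    have h2 := estimate_mono (n := n) hl hp hp1 h1
    have h3 := est_close T hd k hk1 hkn hδ
    generalize Δ * n / (p * (1 - c) * b) = E at *
    have haE : (1 - a) * E ≤ 1 * E := mul_le_mul_of_nonneg_right (by linarith only [ha]) hE
    have h4 : (T.card : ℝ) ≤ b + E := by linarith only [h2, h3, hk]
    rcases le_total (count vI .type1 n + count vI .type2 n) (2 * b) with hle | hge
    · have h5 : (q.2 : ℝ) + T₁.card ≤ T.card := by exact_mod_cast (by omega)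
      rw [hopt'] at hcopt ⊢
      have h6 := mul_le_mul_of_nonneg_left (h5.trans h4) ha1'.le
      linarith only [h6, hcopt, haE]
    · -- here `E ≥ b`, so that the claim is trivial
      have h5 : (T.card : ℝ) = 2 * b := by exact_mod_cast (by omega)
      have h6 : (0 : ℝ) ≤ q.1 + a * q.2 := by positivity
      linarith only [h4, h5, h6, hrev, hcopt, hoptb]
  · -- the last accepted type-2 customer was accepted since the level was not exceeded
    have h1 : max ((b : ℝ) - u1 b a p c v k) 0 ≤ b - T₁.card + Δ * n / (p * (1 - c) * b) := by
      refine max_le ?_ (by linarith only [hT₁b, hE])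
      rcases lt_or_ge ((k : ℝ) / n) (delta n b a c) with hδ | hδ
      · rw [u1, upperBound, if_pos hδ]; linarith only [hT₁b, hE]
      · obtain ⟨hl, -, -, -⟩ := error_bounds hb hbn ha ha1 hp hp1 hc1 hΔ hk1 hkn hδ
        have h2 := est_close T₁ hd1 k hk1 hkn hδ
        have h3 : (arrived π T₁ k : ℝ) ≤ arrived π (kind vI .type1) k := by
          exact_mod_cast arrived_mono π hT₁ k
        have h4 := estimate_mono (n := n) hl hp hp1 h3
        rw [u1_eq hv hδ]
        linarith only [h2, h4]
    rw [threshold] at hk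
    generalize Δ * n / (p * (1 - c) * b) = E at *
    have h2 := mul_le_mul_of_nonneg_left h1 hc
    have h3 : (q.2 : ℝ) ≤ phi a c * b + c * (b - T₁.card + E) + 1 := by linarith only [h2, hk]
    have h4 := mul_le_mul_of_nonneg_left h3 ha1'.le
    have h5 : (1 - a) * (phi a c * b) = (1 - c) * b := by
      rw [phi]; field_simp
    have h6 : (1 - a) * (c * E) ≤ 1 * E := by
      have h7 : c * E ≤ 1 * E := mul_le_mul_of_nonneg_right hc1.le hE
      have h8 : (1 - a) * (c * E) ≤ 1 * (c * E) :=
        mul_le_mul_of_nonneg_right (by linarith only [ha]) (mul_nonneg hc hE)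
      linarith only [h7, h8]
    rw [hopt']
    linarith only [h4, h5, h6, ha]

/-- On every sample path on which the numbers of arrivals of three fixed sets of customers stay
within `Δ` of their means, the algorithm is optimal, or loses only a term of order
`Δ n / (p (1 - c) b)` against `c * opt` while `opt` is of order `b`. The sets are truncated to
sizes of order `b`, so that their fluctuations are governed by `b` and not by `n`. -/
theorem adaptiveRevenue_ge {n b : ℕ} {a p c Δ : ℝ} (hb : 1 ≤ b) (hbn : b ≤ n)
    (ha : 0 < a) (ha1 : a < 1) (hp : 0 < p) (hp1 : p < 1) (hc : 0 ≤ c) (hc1 : c < 1)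
    (hcs : c ≤ cStar n b a p) (hΔ : 0 ≤ Δ)
    {v vI : Fin n → Customer} {π : Equiv.Perm (Fin n)} (hv : ∀ i, v (π i) = vI i)
    {T₁ T₂ T : Finset (Fin n)} (hT₁ : T₁ ⊆ kind vI .type1) (hT₂ : T₂ ⊆ kind vI .type2)
    (hT : T ⊆ kind vI .type1 ∪ kind vI .type2)
    (hT₁c : T₁.card = min b (count vI .type1 n))
    (hT₂c : T₂.card = min (count vI .type2 n) (b - count vI .type1 n))
    (hTc : T.card = min (count vI .type1 n + count vI .type2 n) (2 * b))
    (hdev : ∀ X ∈ ({T₁, T₂, T} : Finset (Finset (Fin n))), ∀ k ∈ Finset.Icc 1 n,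
      |(arrived π X k : ℝ) - meanArrived p X k| ≤ Δ) :
    opt b a vI ≤ adaptiveRevenue n b a p c v ∨
      (a * (1 - c) * b ≤ opt b a vI ∧
        c * opt b a vI - (4 * (Δ * n / (p * (1 - c) * b)) + 1) ≤ adaptiveRevenue n b a p c v) := by
  have hc1' : 0 < 1 - c := by linarith
  have hE : 0 ≤ Δ * n / (p * (1 - c) * b) := by positivity
  have hd1 := fun k h1 h2 => hdev T₁ (by simp) k (Finset.mem_Icc.2 ⟨h1, h2⟩)
  have hd2 := fun k h1 h2 => hdev T₂ (by simp) k (Finset.mem_Icc.2 ⟨h1, h2⟩)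
  have hd := fun k h1 h2 => hdev T (by simp) k (Finset.mem_Icc.2 ⟨h1, h2⟩)
  rcases lt_or_eq_of_le (accepted_bounds b a p c v n le_rfl).1 with hlt | heq
  · rcases adaptiveRevenue_ge_of_lt hb hbn ha ha1 hp hp1 hc hc1 hcs hΔ hv hT₁ hT₂ hT₁c hT₂c hd1 hd2
      hlt with h | ⟨h1, h2⟩
    · exact Or.inl h
    · exact Or.inr ⟨h1, by linarith⟩
  · rcases adaptiveRevenue_ge_of_eq hb hbn ha ha1 hp hp1 hc hc1 hΔ hv hT₁ hT hT₁c hTc hd1 hd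
      heq with h | ⟨h1, h2⟩
    · exact Or.inl h
    · exact Or.inr ⟨h1, by linarith⟩

/-! ### The arrival process as a probability space -/

/-- The expectation of `F S σ`, where each customer belongs to the stochastic group `S`
independently with probability `p`, and `σ` is a uniform permutation of `S`. -/
noncomputable def groupExpect {n : ℕ} (p : ℝ) (F : (S : Finset (Fin n)) → Equiv.Perm S → ℝ) : ℝ :=
  ∑ S : Finset (Fin n), p ^ S.card * (1 - p) ^ (n - S.card) *
    ((∑ σ : Equiv.Perm S, F S σ) / (S.card.factorial : ℝ))

theorem expect_eq_groupExpect {n : ℕ} (p : ℝ) (vI : Fin n → Customer)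
    (f : (Fin n → Customer) → ℝ) :
    expect p vI f = groupExpect p fun S σ => f (arrival vI S σ) := rfl

section Linear

variable {n : ℕ} {p : ℝ}

theorem weight_nonneg (hp : 0 < p) (hp1 : p < 1) (S : Finset (Fin n)) :
    0 ≤ p ^ S.card * (1 - p) ^ (n - S.card) := by
  have : 0 < 1 - p := by linarith
  positivity

theorem groupExpect_mono (hp : 0 < p) (hp1 : p < 1)
    {F G : (S : Finset (Fin n)) → Equiv.Perm S → ℝ} (h : ∀ S σ, F S σ ≤ G S σ) :
    groupExpect p F ≤ groupExpect p G := by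
  refine Finset.sum_le_sum fun S _ => mul_le_mul_of_nonneg_left ?_ (weight_nonneg hp hp1 S)
  gcongr with σ
  exact h S σ

theorem groupExpect_add (F G : (S : Finset (Fin n)) → Equiv.Perm S → ℝ) :
    groupExpect p (fun S σ => F S σ + G S σ) = groupExpect p F + groupExpect p G := by
  simp only [groupExpect]
  rw [← Finset.sum_add_distrib]
  refine Finset.sum_congr rfl fun S _ => ?_
  rw [Finset.sum_add_distrib, add_div, mul_add]

theorem groupExpect_const_mul (r : ℝ) (F : (S : Finset (Fin n)) → Equiv.Perm S → ℝ) :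
    groupExpect p (fun S σ => r * F S σ) = r * groupExpect p F := by
  simp only [groupExpect]
  rw [Finset.mul_sum]
  refine Finset.sum_congr rfl fun S _ => ?_
  rw [← Finset.mul_sum, mul_div_assoc]; ring

theorem groupExpect_sum {ι : Type*} (s : Finset ι)
    (F : ι → (S : Finset (Fin n)) → Equiv.Perm S → ℝ) :
    groupExpect p (fun S σ => ∑ i ∈ s, F i S σ) = ∑ i ∈ s, groupExpect p (F i) := by
  classical
  induction s using Finset.induction_on with
  | empty => simp [groupExpect]
  | insert i s hi ih =>
    simp only [Finset.sum_insert hi]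
    rw [groupExpect_add, ih]

theorem groupExpect_of_set (f : Finset (Fin n) → ℝ) :
    groupExpect p (fun S _ => f S) =
      ∑ S : Finset (Fin n), p ^ S.card * (1 - p) ^ (n - S.card) * f S := by
  refine Finset.sum_congr rfl fun S _ => ?_
  have : (S.card.factorial : ℝ) ≠ 0 := by positivity
  rw [Finset.sum_const, Finset.card_univ, Fintype.card_perm, Fintype.card_coe, nsmul_eq_mul,
    mul_div_cancel_left₀ _ this]

theorem sum_weight : ∑ S : Finset (Fin n), p ^ S.card * (1 - p) ^ (n - S.card) = 1 := by
  have := Fintype.sum_pow_mul_eq_add_pow (Fin n) p (1 - p)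
  simpa using this

theorem groupExpect_const (r : ℝ) : groupExpect (n := n) p (fun _ _ => r) = r := by
  rw [groupExpect_of_set fun _ => r, ← Finset.sum_mul, sum_weight, one_mul]

end Linear

/-! ### Exponential moments -/

theorem exp_le_one_add_add_sq {x : ℝ} (hx : |x| ≤ 1) : Real.exp x ≤ 1 + x + x ^ 2 := by
  have := (abs_le.1 (Real.abs_exp_sub_one_sub_id_le hx)).2
  linarith

theorem bernoulli_exp_le {p x : ℝ} (hp : 0 < p) (hp1 : p < 1) (hx : |x| ≤ 1) :
    p * Real.exp (x * (1 - p)) + (1 - p) * Real.exp (-(x * p)) ≤ Real.exp (p * x ^ 2) := by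
  have hp1' : 0 < 1 - p := by linarith
  have h1 : |x * (1 - p)| ≤ 1 := by
    rw [abs_mul, abs_of_pos hp1']; nlinarith [abs_nonneg x]
  have h2 : |-(x * p)| ≤ 1 := by
    rw [abs_neg, abs_mul, abs_of_pos hp]; nlinarith [abs_nonneg x]
  have e1 := mul_le_mul_of_nonneg_left (exp_le_one_add_add_sq h1) hp.le
  have e2 := mul_le_mul_of_nonneg_left (exp_le_one_add_add_sq h2) hp1'.le
  have e3 := Real.add_one_le_exp (p * x ^ 2)
  have e4 : 0 ≤ p ^ 2 * x ^ 2 := by positivity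
  linarith

/-- The centered sum of the weights `w i` of the members `i` of the stochastic group. -/
noncomputable def centeredSum {n : ℕ} (p : ℝ) (w : Fin n → ℝ) (S : Finset (Fin n)) : ℝ :=
  ∑ i, w i * ((if i ∈ S then 1 else 0) - p)

theorem groupExpect_exp_centeredSum_le {n : ℕ} {p s : ℝ} (hp : 0 < p) (hp1 : p < 1)
    (hs : |s| ≤ 1) {w : Fin n → ℝ} (hw : ∀ i, |w i| ≤ 1) :
    groupExpect p (fun S _ => Real.exp (s * centeredSum p w S)) ≤
      Real.exp (s ^ 2 * (p * ∑ i, w i ^ 2)) := by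
  rw [groupExpect_of_set fun S => Real.exp (s * centeredSum p w S)]
  calc ∑ S : Finset (Fin n), p ^ S.card * (1 - p) ^ (n - S.card) *
        Real.exp (s * centeredSum p w S)
      = ∑ S : Finset (Fin n), (∏ i ∈ S, p * Real.exp (s * w i * (1 - p))) *
          ∏ i ∈ Sᶜ, (1 - p) * Real.exp (-(s * w i * p)) := by
        refine Finset.sum_congr rfl fun S _ => ?_
        rw [Finset.prod_mul_distrib, Finset.prod_mul_distrib, Finset.prod_const,
          Finset.prod_const, Finset.card_compl, Fintype.card_fin, ← Real.exp_sum, ← Real.exp_sum]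
        have : s * centeredSum p w S =
            ∑ i ∈ S, s * w i * (1 - p) + ∑ i ∈ Sᶜ, -(s * w i * p) := by
          rw [centeredSum, Finset.mul_sum, ← Finset.sum_add_sum_compl S]
          congr 1
          · refine Finset.sum_congr rfl fun i hi => ?_
            rw [if_pos hi]; ring
          · refine Finset.sum_congr rfl fun i hi => ?_
            rw [if_neg (Finset.mem_compl.1 hi)]; ring
        rw [this, Real.exp_add]; ring
    _ = ∏ i, (p * Real.exp (s * w i * (1 - p)) + (1 - p) * Real.exp (-(s * w i * p))) :=
        (Fintype.prod_add _ _).symm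
    _ ≤ ∏ i, Real.exp (p * (s * w i) ^ 2) := by
        refine Finset.prod_le_prod (fun i _ => ?_) fun i _ => ?_
        · have : 0 < 1 - p := by linarith
          positivity
        · refine bernoulli_exp_le hp hp1 ?_
          rw [abs_mul]
          exact mul_le_one₀ hs (abs_nonneg _) (hw i)
    _ = Real.exp (s ^ 2 * (p * ∑ i, w i ^ 2)) := by
        rw [← Real.exp_sum, Finset.mul_sum, Finset.mul_sum]
        congr 1
        exact Finset.sum_congr rfl fun i _ => by ring

section Hypergeometric

variable {α : Type*} [DecidableEq α]

/-- The number of elements of `A` that the permutation `σ` moves into `B`. If `σ` is uniform, this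
is a hypergeometric random variable. -/
def hits (A B : Finset α) (σ : Equiv.Perm α) : ℕ := (A.filter fun x => σ x ∈ B).card

theorem hits_insert {A B : Finset α} {x : α} (hx : x ∉ A) (σ : Equiv.Perm α) :
    hits (insert x A) B σ = hits A B σ + if σ x ∈ B then 1 else 0 := by
  unfold hits
  rw [Finset.filter_insert]
  split_ifs with h
  · rw [Finset.card_insert_of_notMem (by simp [hx])]
  · rfl

variable [Fintype α]

theorem hits_univ (B : Finset α) (σ : Equiv.Perm α) : hits Finset.univ B σ = B.card := by
  unfold hits
  refine Finset.card_bij (fun x _ => σ x) (by simp) (fun x _ y _ h => σ.injective h) ?_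
  exact fun y hy => ⟨σ.symm y, by simpa using hy, by simp⟩

/-- By symmetry, all elements outside `A` contribute equally to the sum of a function of
`hits A B` over the event that they are moved into `B`. -/
theorem card_compl_mul_sum_hits (A B : Finset α) {x : α} (hx : x ∉ A) (g : ℕ → ℝ) :
    ((Aᶜ).card : ℝ) * ∑ σ : Equiv.Perm α, g (hits A B σ) * (if σ x ∈ B then 1 else 0) =
      ∑ σ : Equiv.Perm α, g (hits A B σ) * ((B.card : ℝ) - hits A B σ) := by
  have hsym : ∀ y ∈ Aᶜ, ∑ σ : Equiv.Perm α, g (hits A B σ) * (if σ y ∈ B then (1 : ℝ) else 0) =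
      ∑ σ : Equiv.Perm α, g (hits A B σ) * (if σ x ∈ B then 1 else 0) := by
    intro y hy
    rw [Finset.mem_compl] at hy
    refine Fintype.sum_equiv (Equiv.mulRight (Equiv.swap x y)) _ _ fun σ => ?_
    have h1 : hits A B (σ * Equiv.swap x y) = hits A B σ := by
      unfold hits
      congr 1
      refine Finset.filter_congr fun z hz => ?_
      rw [Equiv.Perm.mul_apply, Equiv.swap_apply_of_ne_of_ne]
      · rintro rfl; exact hx hz
      · rintro rfl; exact hy hz
    simp only [Equiv.coe_mulRight, h1, Equiv.Perm.mul_apply, Equiv.swap_apply_left]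
  rw [← nsmul_eq_mul, ← Finset.sum_const, ← Finset.sum_congr rfl hsym, Finset.sum_comm]
  refine Finset.sum_congr rfl fun σ _ => ?_
  rw [← Finset.mul_sum]
  congr 1
  have h2 : (hits Finset.univ B σ : ℝ) = ∑ y, if σ y ∈ B then (1 : ℝ) else 0 := by
    simp [hits]
  have h3 : (hits A B σ : ℝ) = ∑ y ∈ A, if σ y ∈ B then (1 : ℝ) else 0 := by
    simp [hits]
  rw [← hits_univ B σ, h2, h3, ← Finset.sum_add_sum_compl A]
  ring

theorem sum_hits (A B : Finset α) :
    (Fintype.card α : ℝ) * ∑ σ : Equiv.Perm α, (hits A B σ : ℝ) =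
      (Fintype.card α).factorial * (A.card * B.card) := by
  induction A using Finset.induction_on with
  | empty => simp [hits]
  | insert x A hx ih =>
    have h := card_compl_mul_sum_hits ∅ B (x := x) (by simp) (fun _ => 1)
    simp only [hits_insert hx, Finset.card_insert_of_notMem hx]
    have h0 : ∀ σ, hits ∅ B σ = 0 := fun σ => by simp [hits]
    simp only [h0, Finset.compl_empty, Finset.card_univ, one_mul, Nat.cast_zero, sub_zero,
      Finset.sum_const, Fintype.card_perm, nsmul_eq_mul] at h
    push_cast
    rw [Finset.sum_add_distrib, mul_add, ih, h]
    ring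

/-- Comparison of sampling without and with replacement: the exponential moments of the
hypergeometric distribution are dominated by those of the Poisson distribution with the same
mean. -/
theorem sum_exp_hits_le (A B : Finset α) (s : ℝ) :
    ∑ σ : Equiv.Perm α, Real.exp (s * hits A B σ) ≤ (Fintype.card α).factorial *
      Real.exp (A.card * ((B.card : ℝ) / Fintype.card α) * (Real.exp s - 1)) := by
  induction A using Finset.induction_on with
  | empty => simp [hits, Fintype.card_perm]
  | insert x A hx ih =>
    have hN : (0 : ℝ) < Fintype.card α := by
      exact_mod_cast Fintype.card_pos_iff.2 ⟨x⟩
    set N : ℝ := (Fintype.card α : ℝ) with hNdef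
    set θ := Real.exp s - 1 with hθ
    set r : ℝ := (B.card : ℝ) / N with hr
    set μ : ℝ := A.card * r with hμ
    -- the mean of `hits A B` is `μ`
    have hmean : ∑ σ : Equiv.Perm α, ((hits A B σ : ℝ) - μ) = 0 := by
      have h1 := sum_hits A B
      rw [Finset.sum_sub_distrib, Finset.sum_const, Finset.card_univ, Fintype.card_perm,
        nsmul_eq_mul, sub_eq_zero]
      rw [← hNdef] at h1
      rw [← mul_right_inj' hN.ne', h1, hμ, hr]
      field_simp
    -- `hits A B` and its exponential are correlated with the sign of `s`
    have hcorr : 0 ≤ θ * ∑ σ : Equiv.Perm α, Real.exp (s * hits A B σ) * ((hits A B σ : ℝ) - μ) := by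
      have h1 : θ * ∑ σ : Equiv.Perm α, Real.exp (s * hits A B σ) * ((hits A B σ : ℝ) - μ) =
          ∑ σ : Equiv.Perm α, θ * ((Real.exp (s * hits A B σ) - Real.exp (s * μ)) *
            ((hits A B σ : ℝ) - μ)) := by
        rw [← Finset.mul_sum]
        congr 1
        simp only [sub_mul _ _ (_ - μ)]
        rw [Finset.sum_sub_distrib, ← Finset.mul_sum, hmean]
        ring
      rw [h1]
      refine Finset.sum_nonneg fun σ _ => ?_
      rcases le_total 0 s with hs | hs
      · have hθ0 : 0 ≤ θ := by
          have := Real.one_le_exp hs; rw [hθ]; linarith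
        refine mul_nonneg hθ0 ?_
        rcases le_total μ (hits A B σ : ℝ) with h | h
        · exact mul_nonneg (sub_nonneg.2 (Real.exp_le_exp.2 (mul_le_mul_of_nonneg_left h hs)))
            (sub_nonneg.2 h)
        · exact mul_nonneg_of_nonpos_of_nonpos
            (sub_nonpos.2 (Real.exp_le_exp.2 (mul_le_mul_of_nonneg_left h hs))) (sub_nonpos.2 h)
      · have hθ0 : θ ≤ 0 := by
          have := Real.exp_le_one_iff.2 hs; rw [hθ]; linarith
        refine mul_nonneg_of_nonpos_of_nonpos hθ0 ?_
        rcases le_total μ (hits A B σ : ℝ) with h | h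
        · exact mul_nonpos_of_nonpos_of_nonneg
            (sub_nonpos.2 (Real.exp_le_exp.2 (mul_le_mul_of_nonpos_left h hs))) (sub_nonneg.2 h)
        · exact mul_nonpos_of_nonneg_of_nonpos
            (sub_nonneg.2 (Real.exp_le_exp.2 (mul_le_mul_of_nonpos_left h hs))) (sub_nonpos.2 h)
    set G := ∑ σ : Equiv.Perm α, Real.exp (s * hits A B σ) with hG
    set H := ∑ σ : Equiv.Perm α, Real.exp (s * hits A B σ) * (if σ x ∈ B then (1 : ℝ) else 0)
      with hH
    have hins : ∑ σ : Equiv.Perm α, Real.exp (s * hits (insert x A) B σ) = G + θ * H := by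
      rw [hG, hH, Finset.mul_sum, ← Finset.sum_add_distrib]
      refine Finset.sum_congr rfl fun σ _ => ?_
      rw [hits_insert hx]
      split_ifs
      · push_cast
        rw [mul_add, Real.exp_add, mul_one, hθ]; ring
      · simp
    have hsym : ((Aᶜ).card : ℝ) * H = B.card * G -
        ∑ σ : Equiv.Perm α, Real.exp (s * hits A B σ) * (hits A B σ : ℝ) := by
      rw [hH, card_compl_mul_sum_hits A B hx (fun h => Real.exp (s * h)), hG, Finset.mul_sum,
        ← Finset.sum_sub_distrib]
      exact Finset.sum_congr rfl fun σ _ => by ring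
    have hcorr' : θ * (μ * G) ≤
        θ * ∑ σ : Equiv.Perm α, Real.exp (s * hits A B σ) * (hits A B σ : ℝ) := by
      have h1 : ∑ σ : Equiv.Perm α, Real.exp (s * hits A B σ) * ((hits A B σ : ℝ) - μ) =
          ∑ σ : Equiv.Perm α, Real.exp (s * hits A B σ) * (hits A B σ : ℝ) - μ * G := by
        rw [hG, Finset.mul_sum, ← Finset.sum_sub_distrib]
        exact Finset.sum_congr rfl fun σ _ => by ring
      rw [h1] at hcorr
      linarith
    have hAc : ((Aᶜ).card : ℝ) = N - A.card := by
      rw [Finset.card_compl, Nat.cast_sub (Finset.card_le_univ A)]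
    have hAc0 : 0 < N - A.card := by
      rw [← hAc]
      exact_mod_cast Finset.card_pos.2 ⟨x, Finset.mem_compl.2 hx⟩
    have hstep : θ * H ≤ θ * (r * G) := by
      rw [hAc] at hsym
      have h1 : (N - A.card) * (θ * H) ≤ (N - A.card) * (θ * (r * G)) := by
        have h2 : (B.card : ℝ) = N * r := by rw [hr]; field_simp
        have h3 : (N - A.card) * (θ * H) = θ * ((N - A.card) * H) := by ring
        rw [h3, hsym, h2]
        rw [hμ] at hcorr'
        linarith
      exact le_of_mul_le_mul_left h1 hAc0
    have hG0 : 0 ≤ G := Finset.sum_nonneg fun σ _ => (Real.exp_pos _).le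
    rw [hins, Finset.card_insert_of_notMem hx]
    calc G + θ * H ≤ Real.exp (r * θ) * G := by
          have := mul_le_mul_of_nonneg_right (Real.add_one_le_exp (r * θ)) hG0
          linarith
      _ ≤ Real.exp (r * θ) * ((Fintype.card α).factorial * Real.exp (A.card * r * θ)) := by
          gcongr
      _ = _ := by
          push_cast
          rw [show ((A.card : ℝ) + 1) * r * θ = r * θ + A.card * r * θ by ring, Real.exp_add]
          ring

theorem sum_exp_hits_sub_le (A B : Finset α) {s : ℝ} (hs : |s| ≤ 1) :
    ∑ σ : Equiv.Perm α, Real.exp (s * (hits A B σ - A.card * ((B.card : ℝ) / Fintype.card α))) ≤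
      (Fintype.card α).factorial * Real.exp (s ^ 2 * A.card) := by
  have h1 := sum_exp_hits_le A B s
  have hr : (B.card : ℝ) / Fintype.card α ≤ 1 :=
    div_le_one_of_le₀ (by exact_mod_cast Finset.card_le_univ B) (by positivity)
  have hr0 : 0 ≤ (B.card : ℝ) / Fintype.card α := by positivity
  set r := (B.card : ℝ) / Fintype.card α
  have hfac : (0 : ℝ) ≤ (Fintype.card α).factorial := by positivity
  calc ∑ σ : Equiv.Perm α, Real.exp (s * (hits A B σ - A.card * r))
      = (∑ σ : Equiv.Perm α, Real.exp (s * hits A B σ)) * Real.exp (-(s * (A.card * r))) := by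
        rw [Finset.sum_mul]
        refine Finset.sum_congr rfl fun σ _ => ?_
        rw [← Real.exp_add]; congr 1; ring
    _ ≤ ((Fintype.card α).factorial * Real.exp (A.card * r * (Real.exp s - 1))) *
          Real.exp (-(s * (A.card * r))) := by gcongr
    _ = (Fintype.card α).factorial * Real.exp (A.card * r * (Real.exp s - 1 - s)) := by
        rw [mul_assoc, ← Real.exp_add]; congr 2; ring
    _ ≤ _ := by
        refine mul_le_mul_of_nonneg_left (Real.exp_le_exp.2 ?_) hfac
        have h2 : Real.exp s - 1 - s ≤ s ^ 2 := by linarith [exp_le_one_add_add_sq hs]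
        have hA : (0 : ℝ) ≤ A.card := by positivity
        calc A.card * r * (Real.exp s - 1 - s) ≤ A.card * r * s ^ 2 := by gcongr
          _ ≤ A.card * 1 * s ^ 2 := by gcongr
          _ = s ^ 2 * A.card := by ring

end Hypergeometric

/-! ### Tail bounds -/

/-- The indicator of the event that `|x|` exceeds `t`. -/
noncomputable def exceeds (t x : ℝ) : ℝ := if t < |x| then 1 else 0

theorem exceeds_nonneg (t x : ℝ) : 0 ≤ exceeds t x := by
  unfold exceeds; split_ifs <;> norm_num

theorem abs_le_of_exceeds_lt_one {t x : ℝ} (h : exceeds t x < 1) : |x| ≤ t := by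
  by_contra hcon
  rw [exceeds, if_pos (not_le.1 hcon)] at h
  exact lt_irrefl _ h

/-- The Chernoff bound for a random variable with sub-Gaussian exponential moments on `[-1, 1]`. -/
theorem groupExpect_exceeds_le {n : ℕ} {p V L : ℝ} (hp : 0 < p) (hp1 : p < 1)
    {X : (S : Finset (Fin n)) → Equiv.Perm S → ℝ} (hL : 0 < L) (hLV : L ≤ V)
    (hX : ∀ s : ℝ, |s| ≤ 1 →
      groupExpect p (fun S σ => Real.exp (s * X S σ)) ≤ Real.exp (s ^ 2 * V)) :
    groupExpect p (fun S σ => exceeds (2 * √(V * L)) (X S σ)) ≤ 2 * Real.exp (-L) := by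
  have hV : 0 < V := by linarith
  set s := √(L / V) with hs
  have hs0 : 0 ≤ s := Real.sqrt_nonneg _
  have hs1 : |s| ≤ 1 := by
    rw [abs_of_nonneg hs0, hs]
    exact Real.sqrt_le_one.2 ((div_le_one hV).2 hLV)
  have hs2 : s ^ 2 * V = L := by
    rw [hs, Real.sq_sqrt (by positivity)]; field_simp
  have hst : s * (2 * √(V * L)) = 2 * L := by
    have : s * √(V * L) = L := by
      rw [hs, ← Real.sqrt_mul (by positivity), show L / V * (V * L) = L ^ 2 by field_simp,
        Real.sqrt_sq hL.le]
    linarith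
  have hpt : ∀ (S : Finset (Fin n)) (σ : Equiv.Perm S), exceeds (2 * √(V * L)) (X S σ) ≤
      Real.exp (-(2 * L)) * (Real.exp (s * X S σ) + Real.exp (-s * X S σ)) := by
    intro S σ
    unfold exceeds
    split_ifs with h
    · rw [mul_add, ← Real.exp_add, ← Real.exp_add]
      have h0 := mul_le_mul_of_nonneg_left h.le hs0
      rw [hst] at h0
      rcases abs_cases (X S σ) with ⟨h1, -⟩ | ⟨h1, -⟩
      · rw [h1] at h0
        have := Real.one_le_exp (show 0 ≤ -(2 * L) + s * X S σ by linarith)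
        linarith [Real.exp_pos (-(2 * L) + -s * X S σ)]
      · rw [h1] at h0
        have := Real.one_le_exp (show 0 ≤ -(2 * L) + -s * X S σ by linarith)
        linarith [Real.exp_pos (-(2 * L) + s * X S σ)]
    · positivity
  refine (groupExpect_mono hp hp1 hpt).trans ?_
  rw [groupExpect_const_mul, groupExpect_add]
  have e1 := hX s hs1
  have e2 := hX (-s) (by rwa [abs_neg])
  rw [neg_sq, hs2] at e2
  rw [hs2] at e1
  calc Real.exp (-(2 * L)) * _ ≤ Real.exp (-(2 * L)) * (Real.exp L + Real.exp L) := by gcongr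
    _ = 2 * Real.exp (-L) := by
      rw [mul_add, ← Real.exp_add, show -(2 * L) + L = -L by ring]; ring

theorem groupExpect_exceeds_centeredSum_le {n : ℕ} {p V L : ℝ} (hp : 0 < p) (hp1 : p < 1)
    (hL : 0 < L) (hLV : L ≤ V) {w : Fin n → ℝ} (hw : ∀ i, |w i| ≤ 1)
    (hV : p * ∑ i, w i ^ 2 ≤ V) :
    groupExpect p (fun S _ => exceeds (2 * √(V * L)) (centeredSum p w S)) ≤ 2 * Real.exp (-L) := by
  refine groupExpect_exceeds_le hp hp1 (X := fun S _ => centeredSum p w S) hL hLV fun s hs => ?_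
  refine (groupExpect_exp_centeredSum_le hp hp1 hs hw).trans ?_
  gcongr

/-! ### Concentration of the number of arrivals -/

/-- The weights for which `centeredSum` is the deviation, due to the choice of the stochastic group,
of the number of members of `T` that arrive in the first `k` periods. -/
noncomputable def groupWeight {n : ℕ} (T : Finset (Fin n)) (k : ℕ) (i : Fin n) : ℝ :=
  if i ∈ T then (k : ℝ) / n - (if (i : ℕ) < k then 1 else 0) else 0

/-- The weights for which `centeredSum` is the deviation of the number of members of the stochastic
group in the first `k` periods from the fraction `k / n` of the group. -/
noncomputable def slotWeight {n : ℕ} (k : ℕ) (i : Fin n) : ℝ :=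
  (if (i : ℕ) < k then 1 else 0) - (k : ℝ) / n

/-- The deviation of the number of members of `T` in the stochastic group `S` that arrive in the
first `k` periods from its conditional mean, given `S`. -/
noncomputable def permDeviation {n : ℕ} (T : Finset (Fin n)) (k : ℕ) (S : Finset (Fin n))
    (σ : Equiv.Perm S) : ℝ :=
  (hits (T.subtype (· ∈ S)) (Finset.univ.filter fun x : S => ((x : Fin n) : ℕ) < k) σ : ℝ) -
    (T.subtype (· ∈ S)).card *
      (((Finset.univ.filter fun x : S => ((x : Fin n) : ℕ) < k).card : ℝ) / Fintype.card S)

theorem arrival_ofSubtype {n : ℕ} (vI : Fin n → Customer) (S : Finset (Fin n))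
    (σ : Equiv.Perm S) (i : Fin n) :
    arrival vI S σ (Equiv.Perm.ofSubtype σ i) = vI i := by
  unfold arrival
  by_cases hi : i ∈ S
  · rw [Equiv.Perm.ofSubtype_apply_of_mem σ hi, dif_pos (σ ⟨i, hi⟩).2]
    simp
  · rw [Equiv.Perm.ofSubtype_apply_of_not_mem σ hi, dif_neg hi]

theorem time_mem_Icc {n k : ℕ} (hkn : k ≤ n) : 0 ≤ (k : ℝ) / n ∧ (k : ℝ) / n ≤ 1 :=
  ⟨by positivity, div_le_one_of_le₀ (by exact_mod_cast hkn) (by positivity)⟩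

theorem abs_groupWeight_le {n k : ℕ} (hkn : k ≤ n) (T : Finset (Fin n)) (i : Fin n) :
    |groupWeight T k i| ≤ if i ∈ T then 1 else 0 := by
  obtain ⟨h0, h1⟩ := time_mem_Icc hkn
  unfold groupWeight
  rw [abs_le]
  split_ifs <;> constructor <;> linarith

theorem abs_slotWeight_le {n k : ℕ} (hkn : k ≤ n) (i : Fin n) : |slotWeight k i| ≤ 1 := by
  obtain ⟨h0, h1⟩ := time_mem_Icc hkn
  unfold slotWeight
  rw [abs_le]
  split_ifs <;> constructor <;> linarith

theorem sum_groupWeight_sq_le {n k : ℕ} (hkn : k ≤ n) (T : Finset (Fin n)) :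
    ∑ i, groupWeight T k i ^ 2 ≤ T.card := by
  calc ∑ i, groupWeight T k i ^ 2 ≤ ∑ i, (if i ∈ T then (1 : ℝ) else 0) := by
        refine Finset.sum_le_sum fun i _ => ?_
        have h := abs_groupWeight_le hkn T i
        rw [← sq_abs]
        have h0 := abs_nonneg (groupWeight T k i)
        split_ifs at h ⊢ <;> nlinarith
    _ = T.card := by simp

theorem sum_sq_le_of_abs_le_one {n : ℕ} {w : Fin n → ℝ} (hw : ∀ i, |w i| ≤ 1) :
    ∑ i, w i ^ 2 ≤ n := by
  calc ∑ i, w i ^ 2 ≤ ∑ _i : Fin n, (1 : ℝ) := by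
        refine Finset.sum_le_sum fun i _ => ?_
        rw [sq_le_one_iff_abs_le_one]; exact hw i
    _ = n := by simp

theorem centeredSum_one {n : ℕ} (p : ℝ) (S : Finset (Fin n)) :
    centeredSum p (fun _ => 1) S = S.card - p * n := by
  simp [centeredSum, Finset.sum_sub_distrib]
  ring

theorem centeredSum_slotWeight {n k : ℕ} (hn : 0 < n) (hkn : k ≤ n) (p : ℝ)
    (S : Finset (Fin n)) :
    centeredSum p (slotWeight k) S =
      ((S.filter fun i : Fin n => (i : ℕ) < k).card : ℝ) - (k : ℝ) / n * S.card := by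
  have hn' : (n : ℝ) ≠ 0 := by positivity
  have h1 : ∑ i : Fin n, slotWeight k i = 0 := by
    simp only [slotWeight, Finset.sum_sub_distrib, Finset.sum_boole, card_fin_filter_lt hkn,
      Finset.sum_const, Finset.card_univ, Fintype.card_fin, nsmul_eq_mul]
    field_simp; ring
  have h2 : ∑ i : Fin n, slotWeight k i * (if i ∈ S then 1 else 0) = ∑ i ∈ S, slotWeight k i := by
    simp
  simp only [centeredSum, mul_sub, Finset.sum_sub_distrib]
  rw [← Finset.sum_mul, h1, h2]
  simp only [slotWeight, Finset.sum_sub_distrib, Finset.sum_boole, Finset.sum_const, nsmul_eq_mul]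
  ring

theorem centeredSum_groupWeight {n : ℕ} (p : ℝ) (T : Finset (Fin n)) (k : ℕ)
    (S : Finset (Fin n)) :
    centeredSum p (groupWeight T k) S + meanArrived p T k =
      (k : ℝ) / n * (T ∩ S).card + (((T \ S).filter fun i : Fin n => (i : ℕ) < k).card : ℝ) := by
  have h1 : ∑ i : Fin n, groupWeight T k i =
      (k : ℝ) / n * T.card - ((T.filter fun i : Fin n => (i : ℕ) < k).card : ℝ) := by
    simp only [groupWeight, Finset.sum_ite_mem, Finset.univ_inter, Finset.sum_sub_distrib,
      Finset.sum_boole, Finset.sum_const, nsmul_eq_mul]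
    ring
  have h2 : ∑ i : Fin n, groupWeight T k i * (if i ∈ S then 1 else 0) =
      (k : ℝ) / n * (T ∩ S).card -
        (((T ∩ S).filter fun i : Fin n => (i : ℕ) < k).card : ℝ) := by
    have : ∀ i : Fin n, groupWeight T k i * (if i ∈ S then 1 else 0) =
        if i ∈ T ∩ S then (k : ℝ) / n - (if (i : ℕ) < k then 1 else 0) else 0 := by
      intro i
      unfold groupWeight
      by_cases hT : i ∈ T <;> by_cases hS : i ∈ S <;> simp [hT, hS]
    simp only [this, Finset.sum_ite_mem, Finset.univ_inter, Finset.sum_sub_distrib,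
      Finset.sum_boole, Finset.sum_const, nsmul_eq_mul]
    ring
  have h3 : (((T ∩ S).filter fun i : Fin n => (i : ℕ) < k).card : ℝ) +
      (((T \ S).filter fun i : Fin n => (i : ℕ) < k).card : ℝ) =
      ((T.filter fun i : Fin n => (i : ℕ) < k).card : ℝ) := by
    have h := Finset.card_inter_add_card_sdiff (T.filter fun i : Fin n => (i : ℕ) < k) S
    have e1 : (T ∩ S).filter (fun i : Fin n => (i : ℕ) < k) =
        (T.filter fun i : Fin n => (i : ℕ) < k) ∩ S := by
      ext i; simp only [Finset.mem_filter, Finset.mem_inter]; tauto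
    have e2 : (T \ S).filter (fun i : Fin n => (i : ℕ) < k) =
        (T.filter fun i : Fin n => (i : ℕ) < k) \ S := by
      ext i; simp only [Finset.mem_filter, Finset.mem_sdiff]; tauto
    rw [e1, e2]
    exact_mod_cast h
  simp only [centeredSum, mul_sub, Finset.sum_sub_distrib]
  rw [← Finset.sum_mul, h1, h2, meanArrived, ← h3]
  ring

theorem arrived_ofSubtype {n : ℕ} (T : Finset (Fin n)) (k : ℕ) (S : Finset (Fin n))
    (σ : Equiv.Perm S) :
    arrived (Equiv.Perm.ofSubtype σ) T k =
      ((T \ S).filter fun i : Fin n => (i : ℕ) < k).card +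
      hits (T.subtype (· ∈ S)) (Finset.univ.filter fun x : S => ((x : Fin n) : ℕ) < k) σ := by
  unfold arrived
  rw [← Finset.card_sdiff_add_card_inter _ S]
  congr 1
  · congr 1
    ext i
    simp only [Finset.mem_filter, Finset.mem_sdiff]
    constructor
    · rintro ⟨⟨h1, h2⟩, h3⟩
      rw [Equiv.Perm.ofSubtype_apply_of_not_mem σ h3] at h2
      exact ⟨⟨h1, h3⟩, h2⟩
    · rintro ⟨⟨h1, h3⟩, h2⟩
      rw [Equiv.Perm.ofSubtype_apply_of_not_mem σ h3]
      exact ⟨⟨h1, h2⟩, h3⟩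
  · symm
    unfold hits
    refine Finset.card_bij (fun x _ => (x : Fin n)) ?_ (fun x _ y _ h => Subtype.ext h) ?_
    · intro x hx
      simp only [Finset.mem_filter, Finset.mem_subtype, Finset.mem_univ, true_and] at hx
      simp only [Finset.mem_filter, Finset.mem_inter]
      exact ⟨⟨hx.1, by rw [Equiv.Perm.ofSubtype_apply_coe]; exact hx.2⟩, x.2⟩
    · intro i hi
      simp only [Finset.mem_filter, Finset.mem_inter] at hi
      refine ⟨⟨i, hi.2⟩, ?_, rfl⟩
      simp only [Finset.mem_filter, Finset.mem_subtype, Finset.mem_univ, true_and]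
      refine ⟨hi.1.1, ?_⟩
      have := hi.1.2
      rwa [Equiv.Perm.ofSubtype_apply_of_mem σ hi.2] at this

theorem card_subtype_mem {n : ℕ} (T S : Finset (Fin n)) :
    (T.subtype (· ∈ S)).card = (T ∩ S).card := by
  rw [Finset.card_subtype, Finset.filter_mem_eq_inter]

theorem card_univ_filter_coe {n : ℕ} (S : Finset (Fin n)) (k : ℕ) :
    (Finset.univ.filter fun x : S => ((x : Fin n) : ℕ) < k).card =
      (S.filter fun i : Fin n => (i : ℕ) < k).card := by
  refine Finset.card_bij (fun x _ => (x : Fin n)) ?_ (fun x _ y _ h => Subtype.ext h) ?_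
  · intro x hx
    simp only [Finset.mem_filter, Finset.mem_univ, true_and] at hx ⊢
    exact ⟨x.2, hx⟩
  · intro i hi
    simp only [Finset.mem_filter] at hi
    exact ⟨⟨i, hi.1⟩, by simpa using hi.2, rfl⟩

/-- The deviation of the number of arrivals splits into the part due to the membership of the
customers of `T` in the stochastic group, the part due to the permutation, and the part due to the
positions of the group. -/
theorem arrived_sub_meanArrived {n k : ℕ} (p : ℝ) (hn : 0 < n) (hkn : k ≤ n)
    (T : Finset (Fin n)) {S : Finset (Fin n)} (hS : 0 < S.card) (σ : Equiv.Perm S) :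
    (arrived (Equiv.Perm.ofSubtype σ) T k : ℝ) - meanArrived p T k =
      centeredSum p (groupWeight T k) S + permDeviation T k S σ +
        (T ∩ S).card / S.card * centeredSum p (slotWeight k) S := by
  have hS' : (S.card : ℝ) ≠ 0 := by positivity
  have h := centeredSum_groupWeight p T k S
  rw [centeredSum_slotWeight hn hkn, arrived_ofSubtype, permDeviation, card_subtype_mem,
    card_univ_filter_coe, Fintype.card_coe]
  push_cast
  have h' : (((T \ S).filter fun i : Fin n => (i : ℕ) < k).card : ℝ) =
      centeredSum p (groupWeight T k) S + meanArrived p T k - (k : ℝ) / n * (T ∩ S).card := by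
    linarith
  rw [h']
  field_simp
  ring

theorem groupExpect_exceeds_permDeviation_le {n : ℕ} {p V L : ℝ} (hp : 0 < p) (hp1 : p < 1)
    (hL : 0 < L) (hLV : L ≤ V) {T : Finset (Fin n)} (hT : (T.card : ℝ) ≤ V) (k : ℕ) :
    groupExpect p (fun S σ => exceeds (2 * √(V * L)) (permDeviation T k S σ)) ≤
      2 * Real.exp (-L) := by
  refine groupExpect_exceeds_le hp hp1 hL hLV fun s hs => ?_
  calc groupExpect p (fun S σ => Real.exp (s * permDeviation T k S σ))
      ≤ ∑ S : Finset (Fin n), p ^ S.card * (1 - p) ^ (n - S.card) * Real.exp (s ^ 2 * V) := by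
        refine Finset.sum_le_sum fun S _ =>
          mul_le_mul_of_nonneg_left ?_ (weight_nonneg hp hp1 S)
        rw [div_le_iff₀ (by positivity), mul_comm]
        have h := sum_exp_hits_sub_le (T.subtype (· ∈ S))
          (Finset.univ.filter fun x : S => ((x : Fin n) : ℕ) < k) hs
        simp only [Fintype.card_coe] at h
        simp only [permDeviation, Fintype.card_coe]
        refine h.trans ?_
        gcongr
        refine le_trans ?_ hT
        rw [card_subtype_mem]
        exact_mod_cast Finset.card_le_card Finset.inter_subset_left
    _ = Real.exp (s ^ 2 * V) := by rw [← Finset.sum_mul, sum_weight, one_mul]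

/-- The number of exceptional events that occur: the stochastic group, its part in an initial
segment of the periods, or the number of arrivals from a set of the family `𝒯` deviates too much
from its mean. -/
noncomputable def exceptions {n : ℕ} (p t u : ℝ) (𝒯 : Finset (Finset (Fin n)))
    (S : Finset (Fin n)) (σ : Equiv.Perm S) : ℝ :=
  exceeds t (centeredSum p (fun _ => 1) S) +
    ∑ k ∈ Finset.Icc 1 n, (exceeds t (centeredSum p (slotWeight k) S) +
      ∑ T ∈ 𝒯, (exceeds u (centeredSum p (groupWeight T k) S) +
        exceeds u (permDeviation T k S σ)))

theorem exceptions_nonneg {n : ℕ} (p t u : ℝ) (𝒯 : Finset (Finset (Fin n)))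
    (S : Finset (Fin n)) (σ : Equiv.Perm S) : 0 ≤ exceptions p t u 𝒯 S σ := by
  refine add_nonneg (exceeds_nonneg _ _) (Finset.sum_nonneg fun k _ => add_nonneg
    (exceeds_nonneg _ _) (Finset.sum_nonneg fun T _ => add_nonneg (exceeds_nonneg _ _)
    (exceeds_nonneg _ _)))

theorem groupExpect_exceptions_le {n : ℕ} {p V L : ℝ} (hp : 0 < p) (hp1 : p < 1)
    (hL : 0 < L) (hLV : L ≤ V) (hLn : L ≤ p * n) {𝒯 : Finset (Finset (Fin n))}
    (h𝒯 : ∀ T ∈ 𝒯, (T.card : ℝ) ≤ V) (h𝒯c : 𝒯.card ≤ 3) :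
    groupExpect p (exceptions p (2 * √(p * n * L)) (2 * √(V * L)) 𝒯) ≤
      (1 + 7 * n) * (2 * Real.exp (-L)) := by
  set e := 2 * Real.exp (-L) with he
  have he0 : 0 ≤ e := by positivity
  have hslot : ∀ w : Fin n → ℝ, (∀ i, |w i| ≤ 1) →
      groupExpect p (fun S _ => exceeds (2 * √(p * n * L)) (centeredSum p w S)) ≤ e := by
    intro w hw
    refine groupExpect_exceeds_centeredSum_le hp hp1 hL hLn hw ?_
    gcongr
    exact sum_sq_le_of_abs_le_one hw
  unfold exceptions
  rw [groupExpect_add, groupExpect_sum]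
  have hk : ∀ k ∈ Finset.Icc 1 n, groupExpect p (fun S σ =>
      exceeds (2 * √(p * n * L)) (centeredSum p (slotWeight k) S) +
      ∑ T ∈ 𝒯, (exceeds (2 * √(V * L)) (centeredSum p (groupWeight T k) S) +
        exceeds (2 * √(V * L)) (permDeviation T k S σ))) ≤ 7 * e := by
    intro k hk
    have hkn := (Finset.mem_Icc.1 hk).2
    rw [groupExpect_add, groupExpect_sum]
    have hT : ∀ T ∈ 𝒯, groupExpect p (fun S σ =>
        exceeds (2 * √(V * L)) (centeredSum p (groupWeight T k) S) +
        exceeds (2 * √(V * L)) (permDeviation T k S σ)) ≤ 2 * e := by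
      intro T hT
      rw [groupExpect_add]
      have h1 : groupExpect p (fun S _ => exceeds (2 * √(V * L))
          (centeredSum p (groupWeight T k) S)) ≤ e := by
        refine groupExpect_exceeds_centeredSum_le hp hp1 hL hLV (fun i => ?_) ?_
        · refine (abs_groupWeight_le hkn T i).trans ?_
          split_ifs <;> norm_num
        · have h2 := sum_groupWeight_sq_le hkn T
          have h3 := h𝒯 T hT
          have h4 : 0 ≤ ∑ i, groupWeight T k i ^ 2 := Finset.sum_nonneg fun i _ => sq_nonneg _
          nlinarith
      have h2 := groupExpect_exceeds_permDeviation_le hp hp1 hL hLV (h𝒯 T hT) k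
      linarith
    have h1 := hslot (slotWeight k) (abs_slotWeight_le hkn)
    have h2 := Finset.sum_le_card_nsmul 𝒯 _ _ hT
    rw [nsmul_eq_mul] at h2
    have h3 : (𝒯.card : ℝ) ≤ 3 := by exact_mod_cast h𝒯c
    have h4 : (𝒯.card : ℝ) * (2 * e) ≤ 3 * (2 * e) := by gcongr
    linarith
  have h1 := hslot (fun _ => 1) (by simp)
  have h2 := Finset.sum_le_card_nsmul (Finset.Icc 1 n) _ _ hk
  rw [nsmul_eq_mul, Nat.card_Icc, Nat.add_sub_cancel] at h2
  linarith

/-- Away from the exceptional events, the numbers of arrivals from sets of at most `2 b` customers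
deviate from their means by at most a multiple of `√(b L / p)`. -/
theorem abs_arrived_sub_le {n b : ℕ} {p L : ℝ} (hb : 1 ≤ b) (hbn : b ≤ n) (hp : 0 < p)
    (hp1 : p < 1) (hL : 0 < L) (hLn : 16 * L ≤ p * n) {𝒯 : Finset (Finset (Fin n))}
    (h𝒯 : ∀ T ∈ 𝒯, T.card ≤ 2 * b) {S : Finset (Fin n)} {σ : Equiv.Perm S}
    (hexc : exceptions p (2 * √(p * n * L)) (2 * √((2 * b : ℝ) * L)) 𝒯 S σ < 1) {T : Finset (Fin n)}
    (hT : T ∈ 𝒯) {k : ℕ} (hk : k ∈ Finset.Icc 1 n) :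
    |(arrived (Equiv.Perm.ofSubtype σ) T k : ℝ) - meanArrived p T k| ≤ 14 * √(b * L / p) := by
  have hkn := (Finset.mem_Icc.1 hk).2
  have hbR : (1 : ℝ) ≤ b := by exact_mod_cast hb
  have hbnR : (b : ℝ) ≤ n := by exact_mod_cast hbn
  have hnR : (0 : ℝ) < n := by linarith
  have hn : 0 < n := by omega
  have hpn : 0 < p * n := by positivity
  unfold exceptions at hexc
  set t := 2 * √(p * n * L) with ht
  set u := 2 * √((2 * b : ℝ) * L) with hu
  have hTnn : ∀ (k : ℕ) (T : Finset (Fin n)),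
      0 ≤ exceeds u (centeredSum p (groupWeight T k) S) + exceeds u (permDeviation T k S σ) :=
    fun k T => add_nonneg (exceeds_nonneg _ _) (exceeds_nonneg _ _)
  have hknn : ∀ k : ℕ, 0 ≤ exceeds t (centeredSum p (slotWeight k) S) +
      ∑ T ∈ 𝒯, (exceeds u (centeredSum p (groupWeight T k) S) +
        exceeds u (permDeviation T k S σ)) :=
    fun k => add_nonneg (exceeds_nonneg _ _) (Finset.sum_nonneg fun T _ => hTnn k T)
  have hs1 := Finset.single_le_sum (fun k _ => hknn k) hk
  have hs2 := Finset.single_le_sum (fun T _ => hTnn k T) hT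
  have n1 := exceeds_nonneg t (centeredSum p (fun _ => 1) S)
  have n2 := exceeds_nonneg t (centeredSum p (slotWeight k) S)
  have n3 := exceeds_nonneg u (centeredSum p (groupWeight T k) S)
  have n4 := exceeds_nonneg u (permDeviation T k S σ)
  have a1 : |centeredSum p (fun _ => 1) S| ≤ t := abs_le_of_exceeds_lt_one (by linarith)
  have a2 : |centeredSum p (slotWeight k) S| ≤ t := abs_le_of_exceeds_lt_one (by linarith)
  have a3 : |centeredSum p (groupWeight T k) S| ≤ u := abs_le_of_exceeds_lt_one (by linarith)
  have a4 : |permDeviation T k S σ| ≤ u := abs_le_of_exceeds_lt_one (by linarith)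
  have htpn : t ≤ p * n / 2 := by
    have h1 : √(p * n * L) ≤ p * n / 4 := by
      rw [Real.sqrt_le_left (by positivity)]
      nlinarith
    linarith
  have hScard : p * n / 2 ≤ S.card := by
    rw [centeredSum_one] at a1
    have := (abs_le.1 a1).1
    linarith
  have hS0 : (0 : ℝ) < S.card := by linarith
  have hS : 0 < S.card := by exact_mod_cast hS0
  set r := √(b * L / p) with hr
  have hr0 : 0 ≤ r := Real.sqrt_nonneg _
  have hbLp : r ^ 2 = b * L / p := Real.sq_sqrt (by positivity)
  have hu3 : u ≤ 3 * r := by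
    have h1 : √((2 * b : ℝ) * L) ≤ 3 / 2 * r := by
      rw [Real.sqrt_le_left (by positivity), mul_pow, hbLp]
      have h2 : b * L ≤ b * L / p := by
        rw [le_div_iff₀ hp]
        have : 0 < b * L := by positivity
        nlinarith
      nlinarith
    linarith
  have hratio : ((T ∩ S).card : ℝ) / S.card ≤ 4 * b / (p * n) := by
    have h1 : ((T ∩ S).card : ℝ) ≤ 2 * b := by
      exact_mod_cast (Finset.card_le_card Finset.inter_subset_left).trans (h𝒯 T hT)
    calc ((T ∩ S).card : ℝ) / S.card ≤ 2 * b / (p * n / 2) := by gcongr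
      _ = 4 * b / (p * n) := by field_simp; norm_num
  have ht4 : 4 * b / (p * n) * t ≤ 8 * r := by
    have h1 : √(p * n * L) ≤ p * n / b * r := by
      rw [Real.sqrt_le_left (by positivity), mul_pow, hbLp]
      have h2 : (p * n / b) ^ 2 * (b * L / p) = p * n * L * (n / b) := by field_simp
      rw [h2]
      have h3 : 1 ≤ (n : ℝ) / b := by rw [le_div_iff₀ (by linarith)]; linarith
      exact le_mul_of_one_le_right (by positivity) h3
    calc 4 * b / (p * n) * t ≤ 4 * b / (p * n) * (2 * (p * n / b * r)) := by
          rw [ht]; gcongr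
      _ = 8 * r := by field_simp; ring
  have hthird : |(T ∩ S).card / S.card * centeredSum p (slotWeight k) S| ≤ 8 * r := by
    rw [abs_mul, abs_of_nonneg (by positivity)]
    refine le_trans ?_ ht4
    gcongr
  rw [arrived_sub_meanArrived p hn hkn T hS σ]
  refine (abs_add_three _ _ _).trans ?_
  linarith

/-! ### The competitive ratio -/

theorem groupExpect_nonneg {n : ℕ} {p : ℝ} (hp : 0 < p) (hp1 : p < 1)
    {F : (S : Finset (Fin n)) → Equiv.Perm S → ℝ} (h : ∀ S σ, 0 ≤ F S σ) :
    0 ≤ groupExpect p F := by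
  rw [← groupExpect_const (n := n) (p := p) 0]
  exact groupExpect_mono hp hp1 h

theorem adaptiveRevenue_nonneg {n b : ℕ} {a p c : ℝ} (ha : 0 < a) (v : Fin n → Customer) :
    0 ≤ adaptiveRevenue n b a p c v := by
  unfold adaptiveRevenue; positivity

theorem opt_nonneg {n b : ℕ} {a : ℝ} (ha : 0 < a) (vI : Fin n → Customer) : 0 ≤ opt b a vI := by
  unfold opt; positivity

/-- An upper bound `4 * E + 1` on the loss on typical sample paths, and a bound on the probability
of the exceptional events, turn into a competitive ratio. -/
theorem le_expect_adaptiveRevenue {n b : ℕ} {a p c L ε : ℝ} (hb : 1 ≤ b) (hbn : b ≤ n)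
    (ha : 0 < a) (ha1 : a < 1) (hp : 0 < p) (hp1 : p < 1) (hc : 0 ≤ c) (hc1 : c < 1)
    (hcs : c ≤ cStar n b a p) (hL : 0 < L) (hLb : L ≤ 2 * b) (hLn : 16 * L ≤ p * n)
    (hε : 0 ≤ ε)
    (hloss : 4 * (14 * √(b * L / p) * n / (p * (1 - c) * b)) + 1 ≤ ε * (a * (1 - c) * b))
    (hprob : (1 + 7 * n) * (2 * Real.exp (-L)) ≤ ε) (vI : Fin n → Customer) :
    (c - 2 * ε) * opt b a vI ≤ expect p vI (adaptiveRevenue n b a p c) := by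
  obtain ⟨T₁, hT₁, hT₁c⟩ := Finset.exists_subset_card_eq
    (show min b (count vI .type1 n) ≤ (kind vI .type1).card by rw [card_kind]; exact min_le_right _ _)
  obtain ⟨T₂, hT₂, hT₂c⟩ := Finset.exists_subset_card_eq
    (show min (count vI .type2 n) (b - count vI .type1 n) ≤ (kind vI .type2).card by
      rw [card_kind]; exact min_le_left _ _)
  obtain ⟨T, hT, hTc⟩ := Finset.exists_subset_card_eq
    (show min (count vI .type1 n + count vI .type2 n) (2 * b) ≤
        (kind vI .type1 ∪ kind vI .type2).card by
      rw [Finset.card_union_of_disjoint (disjoint_kind vI), card_kind, card_kind]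
      exact min_le_left _ _)
  have h𝒯 : ∀ X ∈ ({T₁, T₂, T} : Finset (Finset (Fin n))), X.card ≤ 2 * b := by
    intro X hX
    simp only [Finset.mem_insert, Finset.mem_singleton] at hX
    rcases hX with rfl | rfl | rfl <;> omega
  have hopt := opt_nonneg (b := b) ha vI
  have hpt : ∀ (S : Finset (Fin n)) (σ : Equiv.Perm S),
      (c - ε) * opt b a vI ≤ adaptiveRevenue n b a p c (arrival vI S σ) + opt b a vI *
        exceptions p (2 * √(p * n * L)) (2 * √((2 * b : ℝ) * L)) {T₁, T₂, T} S σ := by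
    intro S σ
    rcases lt_or_ge (exceptions p (2 * √(p * n * L)) (2 * √((2 * b : ℝ) * L)) {T₁, T₂, T} S σ) 1
      with hexc | hexc
    · have h0 := mul_nonneg hopt (exceptions_nonneg p (2 * √(p * n * L))
        (2 * √((2 * b : ℝ) * L)) {T₁, T₂, T} S σ)
      have hεo := mul_nonneg hε hopt
      rcases adaptiveRevenue_ge hb hbn ha ha1 hp hp1 hc hc1 hcs
        (show (0 : ℝ) ≤ 14 * √(b * L / p) by positivity) (arrival_ofSubtype vI S σ) hT₁ hT₂ hT
        hT₁c hT₂c hTc (fun X hX k hk => abs_arrived_sub_le hb hbn hp hp1 hL hLn h𝒯 hexc hX hk)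
        with h | ⟨h1, h2⟩
      · have : c * opt b a vI ≤ 1 * opt b a vI := by gcongr
        linarith
      · have := mul_le_mul_of_nonneg_left h1 hε
        linarith
    · have h1 := mul_le_mul_of_nonneg_left hexc hopt
      have h2 := adaptiveRevenue_nonneg (n := n) (b := b) (p := p) (c := c) ha (arrival vI S σ)
      have h3 : (c - ε) * opt b a vI ≤ 1 * opt b a vI :=
        mul_le_mul_of_nonneg_right (by linarith) hopt
      linarith
  have h1 := groupExpect_mono hp hp1 hpt
  rw [groupExpect_const, groupExpect_add, groupExpect_const_mul] at h1
  have h2 := groupExpect_exceptions_le (n := n) (V := 2 * b) hp hp1 hL hLb (by linarith)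
    (𝒯 := {T₁, T₂, T}) (fun X hX => by exact_mod_cast h𝒯 X hX) Finset.card_le_three
  have h3 := mul_le_mul_of_nonneg_left (h2.trans hprob) hopt
  rw [expect_eq_groupExpect]
  linarith

/-- If the error term of the competitive ratio is below `1`, then `b p` exceeds a multiple of
`log n`. -/
theorem mul_log_lt {n b : ℕ} {a p c K : ℝ} (hn : 3 ≤ n) (hb : 1 ≤ b) (hbn : b ≤ n)
    (ha : 0 < a) (ha1 : a < 1) (hp : 0 < p) (hp1 : p < 1) (hc : 0 ≤ c) (hc1 : c < 1) (hK : 0 < K)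
    (h : K * (1 / ((1 - c) ^ 2 * a * p ^ (3 / 2 : ℝ)) *
      √((n : ℝ) ^ 2 * Real.log n / (b : ℝ) ^ 3)) < 1) :
    K ^ 2 * Real.log n < p * b := by
  have hbR : (1 : ℝ) ≤ b := by exact_mod_cast hb
  have hbnR : (b : ℝ) ≤ n := by exact_mod_cast hbn
  have hlog : 0 < Real.log n := Real.log_pos (by exact_mod_cast (by omega : 1 < n))
  have hc1' : 0 < 1 - c := by linarith
  set P := p ^ (3 / 2 : ℝ) with hP
  have hP0 : 0 < P := Real.rpow_pos_of_pos hp _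
  have hP2 : P ^ 2 = p ^ 3 := by
    rw [hP, ← Real.rpow_natCast, ← Real.rpow_mul hp.le, ← Real.rpow_natCast]; norm_num
  set R := √((n : ℝ) ^ 2 * Real.log n / (b : ℝ) ^ 3) with hR
  have hR0 : 0 ≤ R := Real.sqrt_nonneg _
  have hR2 : R ^ 2 = (n : ℝ) ^ 2 * Real.log n / (b : ℝ) ^ 3 := Real.sq_sqrt (by positivity)
  have hden : (1 - c) ^ 2 * a * P ≤ P := by
    have h1 : (1 - c) ^ 2 ≤ 1 := by nlinarith
    have h2 : (1 - c) ^ 2 * a ≤ 1 * 1 := by gcongr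
    nlinarith
  have h1 : K * R < P := by
    have h2 : K * (1 / ((1 - c) ^ 2 * a * P) * R) = K * R / ((1 - c) ^ 2 * a * P) := by ring
    rw [h2, div_lt_one (by positivity)] at h
    linarith
  have h2 : (K * R) ^ 2 < P ^ 2 := by gcongr
  rw [mul_pow, hR2, hP2, ← mul_div_assoc, div_lt_iff₀ (by positivity)] at h2
  -- `K² n² log n < p³ b³ ≤ n² p b`
  have h3 : p ^ 3 * (b : ℝ) ^ 3 ≤ (n : ℝ) ^ 2 * (p * b) := by
    have h5 : (p * b) ^ 2 ≤ (n : ℝ) ^ 2 := by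
      have : p * b ≤ n := by nlinarith
      gcongr
    have h6 := mul_le_mul_of_nonneg_right h5 (show 0 ≤ p * b by positivity)
    linarith
  have h4 : (n : ℝ) ^ 2 * (K ^ 2 * Real.log n) < (n : ℝ) ^ 2 * (p * b) := by linarith
  exact lt_of_mul_lt_mul_left h4 (by positivity)

end OnlineAlloc

theorem mainTheorem2 :
    ∃ K : ℝ, 0 < K ∧
      ∀ (n b : ℕ) (a p c : ℝ), 3 ≤ n → 1 ≤ b → b ≤ n →
        0 < a → a < 1 → 0 < p → p < 1 →
        0 ≤ c → c < 1 → c ≤ OnlineAlloc.cStar n b a p →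
        OnlineAlloc.IsCompetitive n b a p (OnlineAlloc.adaptiveRevenue n b a p c)
          (c - K * (1 / ((1 - c) ^ 2 * a * p ^ (3 / 2 : ℝ)) *
            Real.sqrt ((n : ℝ) ^ 2 * Real.log n / (b : ℝ) ^ 3))) := by
  refine ⟨200, by norm_num, ?_⟩
  intro n b a p c hn hb hbn ha ha1 hp hp1 hc hc1 hcs vI
  rcases le_or_gt 1 (200 * (1 / ((1 - c) ^ 2 * a * p ^ (3 / 2 : ℝ)) *
      √((n : ℝ) ^ 2 * Real.log n / (b : ℝ) ^ 3))) with htriv | herr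
  · -- the claimed ratio is not positive
    refine (mul_nonpos_of_nonpos_of_nonneg (by linarith) (OnlineAlloc.opt_nonneg ha vI)).trans ?_
    rw [OnlineAlloc.expect_eq_groupExpect]
    exact OnlineAlloc.groupExpect_nonneg hp hp1 fun S σ => OnlineAlloc.adaptiveRevenue_nonneg ha _
  have hpb := OnlineAlloc.mul_log_lt hn hb hbn ha ha1 hp hp1 hc hc1 (by norm_num) herr
  have hbR : (1 : ℝ) ≤ b := by exact_mod_cast hb
  have hbnR : (b : ℝ) ≤ n := by exact_mod_cast hbn
  have hn3 : (3 : ℝ) ≤ n := by exact_mod_cast hn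
  have hlog : 1 ≤ Real.log n := by
    rw [Real.le_log_iff_exp_le (by linarith)]
    linarith [Real.exp_one_lt_three]
  have hc1' : 0 < 1 - c := by linarith
  set P := p ^ (3 / 2 : ℝ) with hP
  have hP0 : 0 < P := Real.rpow_pos_of_pos hp _
  have hP2 : P ^ 2 = p ^ 3 := by
    rw [hP, ← Real.rpow_natCast, ← Real.rpow_mul hp.le, ← Real.rpow_natCast]; norm_num
  have hP1 : P ≤ 1 := Real.rpow_le_one hp.le hp1.le (by norm_num)
  set R := √((n : ℝ) ^ 2 * Real.log n / (b : ℝ) ^ 3) with hR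
  have hR0 : 0 ≤ R := Real.sqrt_nonneg _
  have hR2 : R ^ 2 = (n : ℝ) ^ 2 * Real.log n / (b : ℝ) ^ 3 := Real.sq_sqrt (by positivity)
  have hpb' : p * b ≤ b := by nlinarith
  have hpbn : p * b ≤ p * n := by gcongr
  have main := OnlineAlloc.le_expect_adaptiveRevenue (L := 2 * Real.log n)
    (ε := 100 * (1 / ((1 - c) ^ 2 * a * P) * R)) hb hbn ha ha1 hp hp1 hc hc1 hcs
    (by linarith) (by linarith) (by linarith) (by positivity) ?_ ?_ vI
  · refine le_trans (le_of_eq ?_) main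
    ring
  · -- the loss, in units of `Q`, which is the error term times the least value of `opt`
    set Q := R * b / ((1 - c) * P) with hQ
    have hQ0 : 0 ≤ Q := by positivity
    have hQ2 : Q ^ 2 = (n : ℝ) ^ 2 * Real.log n / (b * (1 - c) ^ 2 * p ^ 3) := by
      rw [hQ, div_pow, mul_pow, mul_pow, hR2, hP2]; field_simp
    have hQ1 : 1 ≤ Q := by
      rw [← one_le_sq_iff₀ hQ0, hQ2, le_div_iff₀ (by positivity), one_mul]
      have h1 : b * (1 - c) ^ 2 * p ^ 3 ≤ n * 1 * 1 := by
        gcongr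
        · exact pow_le_one₀ hc1'.le (by linarith)
        · exact pow_le_one₀ hp.le hp1.le
      have h2 : (n : ℝ) * 1 ≤ (n : ℝ) ^ 2 * Real.log n := by
        rw [sq, mul_assoc]
        gcongr
        nlinarith
      linarith
    have hX : √(b * (2 * Real.log n) / p) * n / (p * (1 - c) * b) ≤ 3 / 2 * Q := by
      rw [← pow_le_pow_iff_left₀ (by positivity) (by positivity) two_ne_zero, mul_pow, hQ2,
        div_pow, mul_pow, Real.sq_sqrt (by positivity)]
      have h1 : b * (2 * Real.log n) / p * (n : ℝ) ^ 2 / (p * (1 - c) * b) ^ 2 =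
          2 * ((n : ℝ) ^ 2 * Real.log n / (b * (1 - c) ^ 2 * p ^ 3)) := by field_simp
      rw [h1]
      gcongr
      norm_num
    have h1 : 14 * √(b * (2 * Real.log n) / p) * n / (p * (1 - c) * b) =
        14 * (√(b * (2 * Real.log n) / p) * n / (p * (1 - c) * b)) := by ring
    have h2 : 100 * (1 / ((1 - c) ^ 2 * a * P) * R) * (a * (1 - c) * b) = 100 * Q := by
      rw [hQ]; field_simp
    rw [h1, h2]
    linarith
  · have h1 : Real.exp (-(2 * Real.log n)) = 1 / (n : ℝ) ^ 2 := by
      rw [Real.exp_neg, mul_comm, Real.exp_mul, Real.exp_log (by linarith)]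
      norm_num
    have h2 : (1 : ℝ) / n ≤ R := by
      rw [hR]
      refine Real.le_sqrt_of_sq_le ?_
      rw [div_pow, one_pow, div_le_div_iff₀ (by positivity) (by positivity), one_mul]
      calc (b : ℝ) ^ 3 ≤ (n : ℝ) ^ 3 := by gcongr
        _ ≤ (n : ℝ) ^ 4 := by gcongr <;> linarith
        _ ≤ (n : ℝ) ^ 4 * Real.log n := le_mul_of_one_le_right (by positivity) hlog
        _ = _ := by ring
    have h3 : R ≤ 1 / ((1 - c) ^ 2 * a * P) * R := by
      refine le_mul_of_one_le_left hR0 ?_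
      rw [le_div_iff₀ (by positivity), one_mul]
      have h4 : (1 - c) ^ 2 ≤ 1 := pow_le_one₀ hc1'.le (by linarith)
      calc (1 - c) ^ 2 * a * P ≤ 1 * 1 * 1 := by gcongr
        _ = 1 := by norm_num
    have h4 : (1 + 7 * (n : ℝ)) * (2 * (1 / (n : ℝ) ^ 2)) ≤ 16 * (1 / n) := by
      have h5 : 16 * (1 / (n : ℝ)) = (8 * n) * (2 * (1 / (n : ℝ) ^ 2)) := by field_simp; norm_num
      rw [h5]
      gcongr
      linarith
    rw [h1]
    linarith
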